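/- Let $(M,g)$ be a time-oriented smooth four-dimensional space-time (a Hausdorff, second countable smooth manifold with a smooth Lorentzian metric of signature $(+,-,-,-)$), with Levi-Civita connection $\nabla$, Ricci tensor $\mathrm{Ric}_{ac}=R_{abc}{}^{b}$, where $(\nabla_a\nabla_b-\nabla_b\nabla_a)w^d=R_{abc}{}^{d}w^c$, scalar curvature $R=g^{ab}\mathrm{Ric}_{ab}$, and energy-momentum tensor $T_{ab}$. In these conventions, and in units $G=c=1$, Einstein's equations are $\mathrm{Ric}_{ab}-\tfrac12 R\,g_{ab}=-8\pi T_{ab}$. A Newman--Penrose null tetrad is $(l,n,m,\bar m)$ with $l,n$ real, $m$ complex, $l^an_a=1$, $m^a\bar m_a=-1$ and all other contractions zero. Put $q_{ab}=-m_a\bar m_b-\bar m_a m_b$, let $P[\cdot]$ denote the projection of both indices by $q_a{}^b$, and define the expansion $\Theta_{(l)}=q^{ab}\nabla_al_b$, the shear tensor $\sigma_{ab}=P[\nabla_{(a}l_{b)}]-\tfrac12\Theta_{(l)}q_{ab}$, the twist tensor $\omega_{ab}=P[\nabla_{[a}l_{b]}]$, the spin coefficients $\varrho=m^a\bar m^b\nabla_bl_a$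 and $\sigma=m^am^b\nabla_bl_a$, and the Ricci spinor component $\Phi_{00}=-\tfrac12\mathrm{Ric}_{ab}l^al^b$. A non-expanding horizon is a null hypersurface $\mathcal H\subset M$, the image of a smooth embedding of $\mathbb R\times S^2$, such that: 1. every null normal $l^a$ of $\mathcal H$ (a smooth vector field $l$ on an open set $U\subseteq M$ that is nonzero and orthogonal to $\mathcal H$ at each point of $\mathcal H\cap U$) has vanishing expansion on $\mathcal H\cap U$; 2. Einstein's equations hold on $\mathcal H$; 3. at each point of $\mathcal H$ and for each future pointing null normal vector $l^a$ there, the vector $T^a{}_b\,l^b$ is zero or future pointing (causal and future directed). Theorem. Let $\mathcal H$ be a non-expanding horizon, and let $l$ be a null normal of $\mathcal H$ on an open set $U$. Then, at every point of $\mathcal H\cap U$ and for every completion of $l$ to a null tetrad $(l,n,m,\bar m)$ there, $$\omega_{ab}=0,\qquad \sigma_{ab}=0,\qquad \varrho=0,\qquad \sigma=0,\qquad \Phi_{00}=0,$$ that is, the horizon has no twist and no shear, and its Ricci spinor component $\Phi_{00}$ vanishes. -/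

import Mathlib

open scoped Manifold ContDiff

noncomputable section

namespace NonExpanding

/-- The model space of a four-dimensional space-time. -/
abbrev E4 : Type := EuclideanSpace ℝ (Fin 4)

/-- The manifold `ℝ × S²`. -/
abbrev Cylinder : Type := ℝ × Metric.sphere (0 : EuclideanSpace ℝ (Fin 3)) 1

/-- The model with corners of `ℝ × S²`. -/
abbrev cylModel : ModelWithCorners ℝ (ℝ × EuclideanSpace ℝ (Fin 2))
    (ModelProd ℝ (EuclideanSpace ℝ (Fin 2))) :=
  𝓘(ℝ, ℝ).prod (𝓡 2)

section

variable {M : Type*} [TopologicalSpace M] [ChartedSpace E4 M]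

/-- The tangent space of the space-time at `p`. -/
abbrev TS (p : M) : Type := TangentSpace 𝓘(ℝ, E4) p

/-- A vector field as a map into the tangent bundle. -/
abbrev asSection (Y : Π q : M, TangentSpace 𝓘(ℝ, E4) q) (q : M) :
    Bundle.TotalSpace E4 (TangentSpace 𝓘(ℝ, E4) : M → Type _) :=
  Bundle.TotalSpace.mk' E4 q (Y q)

/-- A smooth Lorentzian metric of signature `(+,-,-,-)`. -/
structure LorentzMetric (M : Type*) [TopologicalSpace M] [ChartedSpace E4 M]
    [IsManifold 𝓘(ℝ, E4) ∞ M] where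
  inner (p : M) : TS p →L[ℝ] TS p →L[ℝ] ℝ
  symm (p : M) (v w : TS p) : inner p v w = inner p w v
  signature (p : M) : ∃ b : Module.Basis (Fin 4) ℝ (TS p), ∀ i j,
    inner p (b i) (b j) = if i = j then (if i = 0 then 1 else -1) else 0
  contMDiff : ContMDiff 𝓘(ℝ, E4) (𝓘(ℝ, E4).prod 𝓘(ℝ, E4 →L[ℝ] E4 →L[ℝ] ℝ)) ∞
    (fun p ↦ Bundle.TotalSpace.mk' (E4 →L[ℝ] E4 →L[ℝ] ℝ)
      (E := fun p : M ↦ TS p →L[ℝ] TS p →L[ℝ] ℝ) p (inner p))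

/-- Covariant derivatives on the tangent bundle; `D Y p v` is `∇_v Y` at `p`. -/
abbrev Connection (M : Type*) [TopologicalSpace M] [ChartedSpace E4 M]
    [IsManifold 𝓘(ℝ, E4) ∞ M] : Type _ :=
  CovariantDerivative 𝓘(ℝ, E4) E4 (TangentSpace 𝓘(ℝ, E4) : M → Type _)

variable [IsManifold 𝓘(ℝ, E4) ∞ M]

/-- `D` is the Levi-Civita connection of `g`: the smooth torsion-free metric connection. -/
structure IsLeviCivita (g : LorentzMetric M) (D : Connection M) : Prop where
  smooth : ∀ U : Set M, IsOpen U → ContMDiffCovariantDerivativeOn E4 ∞ D.toFun U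
  torsion_free : D.torsion = 0
  metric : ∀ (p : M) (Y Z : Π q : M, TangentSpace 𝓘(ℝ, E4) q),
    MDifferentiableAt 𝓘(ℝ, E4) (𝓘(ℝ, E4).prod 𝓘(ℝ, E4)) (asSection Y) p →
    MDifferentiableAt 𝓘(ℝ, E4) (𝓘(ℝ, E4).prod 𝓘(ℝ, E4)) (asSection Z) p → ∀ v : TS p, mvfderiv 𝓘(ℝ, E4) (fun q ↦ g.inner q (Y q) (Z q)) p v =
      g.inner p (D Y p v) (Z p) + g.inner p (Y p) (D Z p v)

/-- The curvature operator `R(u,v)w = ∇_u ∇_v w - ∇_v ∇_u w - ∇_[u,v] w` at `p`, computed by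
extending the three vectors to vector fields that are smooth near `p` (the value does not depend on
the extension). In abstract indices this is `R_{abc}{}^d u^a v^b w^c`, where
`(∇_a ∇_b - ∇_b ∇_a) w^d = R_{abc}{}^d w^c`. -/
def curvature (D : Connection M) (p : M) (u v w : TS p) : TS p :=
  let X : Π q : M, TS q := FiberBundle.extend E4 u
  let Y : Π q : M, TS q := FiberBundle.extend E4 v
  let Z : Π q : M, TS q := FiberBundle.extend E4 w
  D (fun q ↦ D Z q (Y q)) p u - D (fun q ↦ D Z q (X q)) p v
    - D Z p (VectorField.mlieBracket 𝓘(ℝ, E4) X Y p)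

/-- A basis of the tangent space; it serves only to write traces. -/
def coordBasis (p : M) : Module.Basis (Fin 4) ℝ (TS p) :=
  (EuclideanSpace.basisFun (Fin 4) ℝ).toBasis

/-- The Ricci tensor `Ric_{ac} = R_{abc}{}^b`, the trace of `v ↦ R(u,v)w`. In this convention,
which goes with the signature `(+,-,-,-)`, Einstein's equations read
`Ric - (1/2) R g = - 8 π T`. -/
def ricci (D : Connection M) (p : M) (u w : TS p) : ℝ :=
  ∑ i, (coordBasis p).repr (curvature D p u (coordBasis p i) w) i

/-- The components `g_{ij}` of the metric at `p` in `coordBasis p`. -/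
def gram (g : LorentzMetric M) (p : M) : Matrix (Fin 4) (Fin 4) ℝ :=
  Matrix.of fun i j ↦ g.inner p (coordBasis p i) (coordBasis p j)

/-- The scalar curvature `g^{ab} Ric_{ab}`. -/
def scalarCurvature (g : LorentzMetric M) (D : Connection M) (p : M) : ℝ :=
  ∑ i, ∑ j, (gram g p)⁻¹ i j * ricci D p (coordBasis p i) (coordBasis p j)

/-- Einstein's equations (in units with `G = c = 1`) at `p`, with energy-momentum tensor `T`. -/
def EinsteinAt (g : LorentzMetric M) (D : Connection M)
    (T : Π p : M, TS p →L[ℝ] TS p →L[ℝ] ℝ) (p : M) : Prop :=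
  ∀ v w : TS p, ricci D p v w - (1 / 2) * scalarCurvature g D p * g.inner p v w
    = -(8 * Real.pi) * T p v w

/-- A time orientation: a continuous timelike vector field. -/
structure TimeOrientation (g : LorentzMetric M) where
  field (p : M) : TangentSpace 𝓘(ℝ, E4) p
  continuous : Continuous (asSection field)
  timelike (p : M) : 0 < g.inner p (field p) (field p)

/-- `v` is a (nonzero) future pointing causal vector. -/
def FuturePointing (g : LorentzMetric M) (τ : TimeOrientation g) (p : M) (v : TS p) : Prop :=
  0 ≤ g.inner p v v ∧ 0 < g.inner p v (τ.field p)

/-- `v` is tangent at `ψ x` to the hypersurface parametrized by `ψ`. -/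
def IsTangent (ψ : Cylinder → M) (x : Cylinder) (v : TS (ψ x)) : Prop :=
  ∃ u : TangentSpace cylModel x, mfderiv cylModel 𝓘(ℝ, E4) ψ x u = v

/-- `v` is orthogonal at `ψ x` to the hypersurface parametrized by `ψ`. -/
def IsNormal (g : LorentzMetric M) (ψ : Cylinder → M) (x : Cylinder) (v : TS (ψ x)) : Prop :=
  ∀ w : TS (ψ x), IsTangent ψ x w → g.inner (ψ x) v w = 0

/-- `ψ` embeds `ℝ × S²` as a null hypersurface: all normal vectors are null. -/
structure IsNullHypersurface (g : LorentzMetric M) (ψ : Cylinder → M) : Prop where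
  embedding : Manifold.IsSmoothEmbedding cylModel 𝓘(ℝ, E4) ∞ ψ
  null : ∀ (x : Cylinder) (v : TS (ψ x)), IsNormal g ψ x v → g.inner (ψ x) v v = 0

/-- `l` is a smooth vector field on the open set `U` whose restriction to the part of the
hypersurface in `U` is a nowhere vanishing normal. -/
structure IsNullNormalOn (g : LorentzMetric M) (ψ : Cylinder → M) (U : Set M)
    (l : Π p : M, TangentSpace 𝓘(ℝ, E4) p) : Prop where
  isOpen : IsOpen U
  smooth : ContMDiffOn 𝓘(ℝ, E4) (𝓘(ℝ, E4).prod 𝓘(ℝ, E4)) ∞ (asSection l) U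
  ne_zero : ∀ x, ψ x ∈ U → l (ψ x) ≠ 0
  normal : ∀ x, ψ x ∈ U → IsNormal g ψ x (l (ψ x))

/-- A complexified tangent vector `z = z.1 + i z.2`. -/
abbrev CTS (p : M) : Type := TS p × TS p

/-- Complex conjugation. -/
def conjV {p : M} (z : CTS p) : CTS p := (z.1, -z.2)

/-- The complex bilinear extension of the metric. -/
def innerC (g : LorentzMetric M) (p : M) (z w : CTS p) : ℂ :=
  ⟨g.inner p z.1 w.1 - g.inner p z.2 w.2, g.inner p z.1 w.2 + g.inner p z.2 w.1⟩

/-- `∇_z l` for a real vector field `l` and a complex vector `z`. -/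
def covC (D : Connection M) (l : Π p : M, TangentSpace 𝓘(ℝ, E4) p) (p : M) (z : CTS p) : CTS p :=
  (D l p z.1, D l p z.2)

/-- A Newman-Penrose null tetrad `(l, n, m, m̄)` at the point `p`: `l^a n_a = 1`,
`m^a m̄_a = -1`, and all other contractions vanish (those with `m̄` by conjugation). -/
structure NullTetrad (g : LorentzMetric M) (p : M) where
  l : TS p
  n : TS p
  m : CTS p
  l_l : g.inner p l l = 0
  n_n : g.inner p n n = 0
  l_n : g.inner p l n = 1
  m_m : innerC g p m m = 0
  m_conj : innerC g p m (conjV m) = -1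
  l_m : innerC g p (l, 0) m = 0
  n_m : innerC g p (n, 0) m = 0

/-- The spin coefficient `ϱ = m^a m̄^b ∇_b l_a`. -/
def spinRho (g : LorentzMetric M) (D : Connection M) (l : Π p : M, TangentSpace 𝓘(ℝ, E4) p) {p : M}
    (t : NullTetrad g p) : ℂ :=
  innerC g p t.m (covC D l p (conjV t.m))

/-- The spin coefficient `σ = m^a m^b ∇_b l_a`. -/
def spinSigma (g : LorentzMetric M) (D : Connection M) (l : Π p : M, TangentSpace 𝓘(ℝ, E4) p) {p : M}
    (t : NullTetrad g p) : ℂ :=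
  innerC g p t.m (covC D l p t.m)

/-- The component `Φ₀₀ = -(1/2) Ric_{ab} l^a l^b` of the Ricci spinor. -/
def Phi00 {g : LorentzMetric M} (D : Connection M) {p : M} (t : NullTetrad g p) : ℝ :=
  -(1 / 2) * ricci D p t.l t.l

/-- `q_{ab} v^a w^b`, where `q_{ab} = - m_a m̄_b - m̄_a m_b`; the right side is real. -/
def screenMetric {g : LorentzMetric M} {p : M} (t : NullTetrad g p) (v w : TS p) : ℝ :=
  (-(innerC g p t.m (v, 0) * innerC g p (conjV t.m) (w, 0))
    - innerC g p (conjV t.m) (v, 0) * innerC g p t.m (w, 0)).re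

/-- The projection `v^a ↦ q^a{}_b v^b = - m^a m̄_b v^b - m̄^a m_b v^b` onto the real plane spanned
by `m` and `m̄`; in real terms, with `m = x + i y`, it is `-2 (x_b v^b) x^a - 2 (y_b v^b) y^a`. -/
def screenProj {g : LorentzMetric M} {p : M} (t : NullTetrad g p) (v : TS p) : TS p :=
  (-2 * g.inner p t.m.1 v) • t.m.1 + (-2 * g.inner p t.m.2 v) • t.m.2

/-- The expansion `Θ = q^{ab} ∇_a l_b = - (m^a m̄^b + m̄^a m^b) ∇_a l_b`; the right side is real. -/
def expansion (g : LorentzMetric M) (D : Connection M) (l : Π p : M, TangentSpace 𝓘(ℝ, E4) p) {p : M}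
    (t : NullTetrad g p) : ℝ :=
  (-(innerC g p (covC D l p t.m) (conjV t.m))
    - innerC g p (covC D l p (conjV t.m)) t.m).re

/-- The shear tensor: the projection of `∇_(a l_b)` minus `(1/2) Θ q_{ab}`. -/
def shearTensor (g : LorentzMetric M) (D : Connection M) (l : Π p : M, TangentSpace 𝓘(ℝ, E4) p) {p : M}
    (t : NullTetrad g p) (v w : TS p) : ℝ :=
  (1 / 2) * (g.inner p (D l p (screenProj t v)) (screenProj t w)
      + g.inner p (D l p (screenProj t w)) (screenProj t v))
    - (1 / 2) * expansion g D l t * screenMetric t v w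

/-- The twist tensor: the projection of `∇_[a l_b]`. -/
def twistTensor (g : LorentzMetric M) (D : Connection M) (l : Π p : M, TangentSpace 𝓘(ℝ, E4) p) {p : M}
    (t : NullTetrad g p) (v w : TS p) : ℝ :=
  (1 / 2) * (g.inner p (D l p (screenProj t v)) (screenProj t w)
    - g.inner p (D l p (screenProj t w)) (screenProj t v))

/-- `ψ` parametrizes a non-expanding horizon `ψ(ℝ × S²)` in the space-time `(M, g)` with
Levi-Civita connection `D`, time orientation `τ` and energy-momentum tensor `T`. In the energy
condition, the vector `T^a{}_b l^b` may vanish, as it does in vacuum. -/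
structure IsNonExpandingHorizon (g : LorentzMetric M) (D : Connection M) (τ : TimeOrientation g)
    (T : Π p : M, TS p →L[ℝ] TS p →L[ℝ] ℝ) (ψ : Cylinder → M) : Prop where
  nullHypersurface : IsNullHypersurface g ψ
  expansion_eq_zero : ∀ (U : Set M) (l : Π p : M, TangentSpace 𝓘(ℝ, E4) p), IsNullNormalOn g ψ U l →
    ∀ x, ψ x ∈ U → ∀ t : NullTetrad g (ψ x), t.l = l (ψ x) → expansion g D l t = 0
  einstein : ∀ x, EinsteinAt g D T (ψ x)
  energy : ∀ (x : Cylinder) (l : TS (ψ x)), IsNormal g ψ x l → FuturePointing g τ (ψ x) l →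
    ∃ V : TS (ψ x), (∀ w, g.inner (ψ x) V w = T (ψ x) w l) ∧
      (V = 0 ∨ FuturePointing g τ (ψ x) V)

end

end NonExpanding

end

noncomputable section

namespace NonExpanding

open Set Filter Topology VectorField

/-! Write $B(v,w)=g(\nabla_v l,w)$ for $v,w$ orthogonal to $l$. Such vectors are tangent to the
horizon, because the gradient of a function vanishing on it is a normal, all normals are null, and
orthogonal null vectors are proportional. Tangent fields have tangent brackets, so $B$ is symmetric
(`inner_cov_symm`), which kills the twist. Since $l$ is null along the horizon, $B(l,\cdot)=0$: thus
$l$ is pregeodesic and $B$ lives on the screen plane spanned by the real and imaginary parts $x,y$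
of $m$.

The remaining input is Raychaudhuri's equation (`ricci_eq_of_expansion_eq_zero`). The expansion
vanishes along the whole horizon, so its derivative along $l$ vanishes too; commuting derivatives
leaves $\mathrm{Ric}(l,l)=4(B_{xx}^2+2B_{xy}^2+B_{yy}^2)$. Einstein's equations and the energy
condition give $\mathrm{Ric}(l,l)=-8\pi T(l,l)\le 0$ in this sign convention. Hence both sides are
zero, and with them $\Phi_{00}$ and every screen component of $\nabla l$.

Tetrads are given only at points. To differentiate, the vanishing of the expansion is rewritten as a
polynomial identity in an arbitrary smooth frame $E,F$ orthogonal to $l$ (`screen_trace_eq_zero`),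
so no smooth tetrad field is needed. -/

/-! ### The Lie bracket as a commutator of derivations, through charts. -/

lemma fderiv_fderiv_apply_sub {E : Type*} [NormedAddCommGroup E] [NormedSpace ℝ E]
    {f : E → ℝ} {V W : E → E} {z : E} (hf : ContDiffAt ℝ 2 f z)
    (hV : DifferentiableAt ℝ V z) (hW : DifferentiableAt ℝ W z) :
    fderiv ℝ (fun y ↦ fderiv ℝ f y (W y)) z (V z) - fderiv ℝ (fun y ↦ fderiv ℝ f y (V y)) z (W z)
      = fderiv ℝ f z (lieBracket ℝ V W z) := by
  have h1 : DifferentiableAt ℝ (fderiv ℝ f) z :=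
    (hf.fderiv_right (m := 1) le_rfl).differentiableAt one_ne_zero
  have hs : IsSymmSndFDerivAt ℝ f z := hf.isSymmSndFDerivAt (by simp)
  rw [fderiv_clm_apply h1 hW, fderiv_clm_apply h1 hV]
  simp only [lieBracket, add_apply, ContinuousLinearMap.comp_apply,
    ContinuousLinearMap.flip_apply, map_sub]
  rw [hs.eq (V z) (W z)]
  ring

section
variable {E : Type*} [NormedAddCommGroup E] [NormedSpace ℝ E]
  {M : Type*} [TopologicalSpace M] [ChartedSpace E M]

lemma mvfderiv_congr_of_eventuallyEq {p : M} {f h : M → ℝ} (hfh : f =ᶠ[𝓝 p] h)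
    (v : TangentSpace 𝓘(ℝ, E) p) :
    mvfderiv 𝓘(ℝ, E) f p v = mvfderiv 𝓘(ℝ, E) h p v :=
  congrArg (fun A : E →L[ℝ] ℝ ↦ A v) hfh.mfderiv_eq

variable [IsManifold 𝓘(ℝ, E) 2 M]

/-- Chart form of the function $Yf$. It is needed on a neighbourhood of $p$, not just at $p$,
because $Yf$ is differentiated again. -/
lemma mvfderiv_apply_eventuallyEq {p : M} {f : M → ℝ}
    (hf : ContMDiffAt 𝓘(ℝ, E) 𝓘(ℝ, ℝ) 2 f p) (Y : Π q : M, TangentSpace 𝓘(ℝ, E) q) :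
    (fun q ↦ mvfderiv 𝓘(ℝ, E) f q (Y q)) =ᶠ[𝓝 p]
      (fun z : E ↦ fderiv ℝ (f ∘ (extChartAt 𝓘(ℝ, E) p).symm) z
        (mpullbackWithin 𝓘(ℝ, E) 𝓘(ℝ, E) (extChartAt 𝓘(ℝ, E) p).symm Y (range 𝓘(ℝ, E)) z)) ∘
        extChartAt 𝓘(ℝ, E) p := by
  have hev := (contMDiffAt_iff_contMDiffAt_nhds (by simp)).1 hf
  filter_upwards [hev, extChartAt_source_mem_nhds (I := 𝓘(ℝ, E)) p] with q hq hqs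
  have hz : extChartAt 𝓘(ℝ, E) p q ∈ (extChartAt 𝓘(ℝ, E) p).target :=
    (extChartAt 𝓘(ℝ, E) p).map_source hqs
  have hinv := isInvertible_mfderivWithin_extChartAt_symm (I := 𝓘(ℝ, E)) hz
  have hleft : (extChartAt 𝓘(ℝ, E) p).symm (extChartAt 𝓘(ℝ, E) p q) = q :=
    (extChartAt 𝓘(ℝ, E) p).left_inv hqs
  rw [Function.comp_apply]
  generalize extChartAt 𝓘(ℝ, E) p q = z at *
  subst hleft
  have hsymm : MDifferentiableAt 𝓘(ℝ, E) 𝓘(ℝ, E) (extChartAt 𝓘(ℝ, E) p).symm z := by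
    have := mdifferentiableWithinAt_extChartAt_symm (I := 𝓘(ℝ, E)) hz
    rwa [modelWithCornersSelf_coe, range_id, mdifferentiableWithinAt_univ] at this
  have hcomp := mvfderiv_comp_apply z (hq.mdifferentiableAt two_ne_zero) hsymm
    (mpullbackWithin 𝓘(ℝ, E) 𝓘(ℝ, E) (extChartAt 𝓘(ℝ, E) p).symm Y (range 𝓘(ℝ, E)) z)
  have hY : mfderiv 𝓘(ℝ, E) 𝓘(ℝ, E) (extChartAt 𝓘(ℝ, E) p).symm z
      (mpullbackWithin 𝓘(ℝ, E) 𝓘(ℝ, E) (extChartAt 𝓘(ℝ, E) p).symm Y (range 𝓘(ℝ, E)) z)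
      = Y ((extChartAt 𝓘(ℝ, E) p).symm z) := by
    rw [mpullbackWithin_apply]
    have := hinv.self_apply_inverse (Y ((extChartAt 𝓘(ℝ, E) p).symm z))
    rwa [modelWithCornersSelf_coe, range_id, mfderivWithin_univ] at this ⊢
  rw [hY] at hcomp
  rw [← hcomp]
  exact congrArg (fun A : E →L[ℝ] ℝ ↦ A (mpullbackWithin 𝓘(ℝ, E) 𝓘(ℝ, E)
    (extChartAt 𝓘(ℝ, E) p).symm Y (range 𝓘(ℝ, E)) z)) mfderiv_eq_fderiv

lemma mvfderiv_comp_extChartAt_apply {p : M} {G : E → ℝ}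
    (hG : DifferentiableAt ℝ G (extChartAt 𝓘(ℝ, E) p p)) (v : TangentSpace 𝓘(ℝ, E) p) :
    mvfderiv 𝓘(ℝ, E) (G ∘ extChartAt 𝓘(ℝ, E) p) p v
      = fderiv ℝ G (extChartAt 𝓘(ℝ, E) p p) v := by
  rw [mvfderiv_comp_apply p hG.mdifferentiableAt (mdifferentiableAt_extChartAt (by simp)),
    mfderiv_extChartAt_self]
  exact congrArg (fun A : E →L[ℝ] ℝ ↦ A v) mfderiv_eq_fderiv

lemma mpullbackWithin_extChartAt_symm_self {p : M} (X : Π q : M, TangentSpace 𝓘(ℝ, E) q) :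
    mpullbackWithin 𝓘(ℝ, E) 𝓘(ℝ, E) (extChartAt 𝓘(ℝ, E) p).symm X (range 𝓘(ℝ, E))
      (extChartAt 𝓘(ℝ, E) p p) = X p := by
  rw [mpullbackWithin_apply]
  have h := mfderivWithin_extChartAt_symm_inverse_apply (I := 𝓘(ℝ, E)) (x := p) (X p)
  rw [extChartAt_to_inv (I := 𝓘(ℝ, E)) p]
  exact h

lemma contDiffAt_comp_extChartAt_symm {p : M} {f : M → ℝ}
    (hf : ContMDiffAt 𝓘(ℝ, E) 𝓘(ℝ, ℝ) 2 f p) :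
    ContDiffAt ℝ 2 (f ∘ (extChartAt 𝓘(ℝ, E) p).symm) (extChartAt 𝓘(ℝ, E) p p) := by
  have hs : ContMDiffAt 𝓘(ℝ, E) 𝓘(ℝ, E) 2 (extChartAt 𝓘(ℝ, E) p).symm
      (extChartAt 𝓘(ℝ, E) p p) := by
    have := contMDiffWithinAt_extChartAt_symm_range (I := 𝓘(ℝ, E)) (n := 2) p
      (mem_extChartAt_target p)
    rwa [modelWithCornersSelf_coe, range_id, contMDiffWithinAt_univ] at this
  exact (hf.comp_of_eq hs (extChartAt_to_inv p)).contDiffAt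

variable [CompleteSpace E] {X Y : Π q : M, TangentSpace 𝓘(ℝ, E) q}

lemma differentiableAt_mpullbackWithin_extChartAt_symm {p : M}
    (hX : MDifferentiableAt 𝓘(ℝ, E) (𝓘(ℝ, E).prod 𝓘(ℝ, E))
      (fun q ↦ (Bundle.TotalSpace.mk' E q (X q))) p) :
    DifferentiableAt ℝ (fun z : E ↦ (mpullbackWithin 𝓘(ℝ, E) 𝓘(ℝ, E) (extChartAt 𝓘(ℝ, E) p).symm X
      (range 𝓘(ℝ, E)) z : E)) (extChartAt 𝓘(ℝ, E) p p) := by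
  have h := (mdifferentiableWithinAt_univ.2 hX).differentiableWithinAt_mpullbackWithin_vectorField
  have hset : (extChartAt 𝓘(ℝ, E) p).symm ⁻¹' univ ∩ range 𝓘(ℝ, E) = univ := by simp
  rw [hset] at h
  exact differentiableWithinAt_univ.1 h

lemma mdifferentiableAt_mvfderiv_apply {p : M} {f : M → ℝ}
    (hf : ContMDiffAt 𝓘(ℝ, E) 𝓘(ℝ, ℝ) 2 f p)
    (hY : MDifferentiableAt 𝓘(ℝ, E) (𝓘(ℝ, E).prod 𝓘(ℝ, E))
      (fun q ↦ (Bundle.TotalSpace.mk' E q (Y q))) p) :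
    MDifferentiableAt 𝓘(ℝ, E) 𝓘(ℝ, ℝ) (fun q ↦ mvfderiv 𝓘(ℝ, E) f q (Y q)) p := by
  refine MDifferentiableAt.congr_of_eventuallyEq ?_ (mvfderiv_apply_eventuallyEq hf Y)
  have h1 := ((contDiffAt_comp_extChartAt_symm hf).fderiv_right (m := 1) le_rfl).differentiableAt
    one_ne_zero
  exact (h1.clm_apply
    (differentiableAt_mpullbackWithin_extChartAt_symm hY)).mdifferentiableAt.comp p
      (mdifferentiableAt_extChartAt (by simp))

lemma mvfderiv_mvfderiv_apply_sub {p : M} {f : M → ℝ}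
    (hf : ContMDiffAt 𝓘(ℝ, E) 𝓘(ℝ, ℝ) 2 f p)
    (hX : MDifferentiableAt 𝓘(ℝ, E) (𝓘(ℝ, E).prod 𝓘(ℝ, E))
      (fun q ↦ (Bundle.TotalSpace.mk' E q (X q))) p)
    (hY : MDifferentiableAt 𝓘(ℝ, E) (𝓘(ℝ, E).prod 𝓘(ℝ, E))
      (fun q ↦ (Bundle.TotalSpace.mk' E q (Y q))) p) :
    mvfderiv 𝓘(ℝ, E) (fun q ↦ mvfderiv 𝓘(ℝ, E) f q (Y q)) p (X p)
      - mvfderiv 𝓘(ℝ, E) (fun q ↦ mvfderiv 𝓘(ℝ, E) f q (X q)) p (Y p)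
      = mvfderiv 𝓘(ℝ, E) f p (mlieBracket 𝓘(ℝ, E) X Y p) := by
  set φ := extChartAt 𝓘(ℝ, E) p with hφ
  set X' := mpullbackWithin 𝓘(ℝ, E) 𝓘(ℝ, E) φ.symm X (range 𝓘(ℝ, E)) with hX'
  set Y' := mpullbackWithin 𝓘(ℝ, E) 𝓘(ℝ, E) φ.symm Y (range 𝓘(ℝ, E)) with hY'
  have hdX : DifferentiableAt ℝ X' (φ p) := differentiableAt_mpullbackWithin_extChartAt_symm hX
  have hdY : DifferentiableAt ℝ Y' (φ p) := differentiableAt_mpullbackWithin_extChartAt_symm hY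
  have hfφ : ContDiffAt ℝ 2 (f ∘ φ.symm) (φ p) := contDiffAt_comp_extChartAt_symm hf
  have hff : f =ᶠ[𝓝 p] (f ∘ φ.symm) ∘ φ := by
    filter_upwards [extChartAt_source_mem_nhds (I := 𝓘(ℝ, E)) p] with q hq
    rw [Function.comp_apply, Function.comp_apply, hφ, (extChartAt 𝓘(ℝ, E) p).left_inv hq]
  have h1 : DifferentiableAt ℝ (fderiv ℝ (f ∘ φ.symm)) (φ p) :=
    (hfφ.fderiv_right (m := 1) le_rfl).differentiableAt one_ne_zero
  have key := fderiv_fderiv_apply_sub hfφ hdX hdY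
  rw [mvfderiv_congr_of_eventuallyEq (mvfderiv_apply_eventuallyEq hf Y),
    mvfderiv_congr_of_eventuallyEq (mvfderiv_apply_eventuallyEq hf X),
    mvfderiv_congr_of_eventuallyEq hff,
    mvfderiv_comp_extChartAt_apply (h1.clm_apply hdY),
    mvfderiv_comp_extChartAt_apply (h1.clm_apply hdX),
    mvfderiv_comp_extChartAt_apply (hfφ.differentiableAt two_ne_zero)]
  have hXp : X' (φ p) = X p := mpullbackWithin_extChartAt_symm_self X
  have hYp : Y' (φ p) = Y p := mpullbackWithin_extChartAt_symm_self Y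
  have hset : (extChartAt 𝓘(ℝ, E) p).symm ⁻¹' univ ∩ range 𝓘(ℝ, E) = univ := by simp
  -- The derivative of the preferred chart at its own base point is the identity, so the bracket at
  -- $p$ is literally that of the chart representatives.
  have hbr : mlieBracket 𝓘(ℝ, E) X Y p = lieBracket ℝ X' Y' (φ p) := by
    rw [← mlieBracketWithin_univ, mlieBracketWithin_apply, mfderiv_extChartAt_self, hset]
    erw [ContinuousLinearMap.inverse_id]
    exact congrFun (lieBracketWithin_univ (𝕜 := ℝ) (V := X') (W := Y')) (φ p)
  rw [hXp, hYp] at key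
  rw [hbr]
  exact key
end

/-! ### Tangent vectors of an immersion, detected by functions vanishing on it. -/

section
variable {E : Type*} [NormedAddCommGroup E] [NormedSpace ℝ E]
  {H : Type*} [TopologicalSpace H] {I : ModelWithCorners ℝ E H}
  {N : Type*} [TopologicalSpace N] [ChartedSpace H N]
  {E' : Type*} [NormedAddCommGroup E'] [NormedSpace ℝ E']
  {M : Type*} [TopologicalSpace M] [ChartedSpace E' M]

lemma mvfderiv_mfderiv_eq_zero {ψ : N → M} {x : N} (hψ : MDifferentiableAt I 𝓘(ℝ, E') ψ x)
    {f : M → ℝ} (hf : MDifferentiableAt 𝓘(ℝ, E') 𝓘(ℝ, ℝ) f (ψ x))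
    (h0 : ∀ᶠ y in 𝓝 x, f (ψ y) = 0) (u : TangentSpace I x) :
    mvfderiv 𝓘(ℝ, E') f (ψ x) (mfderiv I 𝓘(ℝ, E') ψ x u) = 0 := by
  rw [← mvfderiv_comp_apply x hf hψ]
  have h : f ∘ ψ =ᶠ[𝓝 x] fun _ ↦ (0 : ℝ) := h0
  have h1 := h.mfderiv_eq (I := I) (I' := 𝓘(ℝ, ℝ))
  have h2 : mvfderiv I (f ∘ ψ) x = mvfderiv I (fun _ ↦ (0 : ℝ)) x := by
    unfold mvfderiv
    rw [h1]; rfl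
  rw [h2, mvfderiv_const]; rfl

variable [I.Boundaryless]

/-- A vector that annihilates every function vanishing along an immersion is tangent to it. -/
lemma mem_range_mfderiv_of_forall_mvfderiv_eq_zero {ψ : N → M} {x : N}
    (hψ : Manifold.IsImmersionAt I 𝓘(ℝ, E') ∞ ψ x) {w : TangentSpace 𝓘(ℝ, E') (ψ x)}
    (h : ∀ f : M → ℝ, ContMDiffAt 𝓘(ℝ, E') 𝓘(ℝ, ℝ) ∞ f (ψ x) → (∀ᶠ y in 𝓝 x, f (ψ y) = 0) →
      mvfderiv 𝓘(ℝ, E') f (ψ x) w = 0) : ∃ u, mfderiv I 𝓘(ℝ, E') ψ x u = w := by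
  set A := hψ.domChart with hA
  set B := hψ.codChart with hB
  set e := hψ.equiv with he
  have hw := hψ.writtenInCharts
  have hxA : x ∈ A.source := hψ.mem_domChart_source
  have hxB : ψ x ∈ B.source := hψ.mem_codChart_source
  have hBm : B.MDifferentiable 𝓘(ℝ, E') 𝓘(ℝ, E') :=
    ⟨(contMDiffOn_of_mem_maximalAtlas hψ.codChart_mem_maximalAtlas).mdifferentiableOn (by simp),
      (contMDiffOn_symm_of_mem_maximalAtlas
        hψ.codChart_mem_maximalAtlas).mdifferentiableOn (by simp)⟩
  have hBs : ContMDiffAt 𝓘(ℝ, E') 𝓘(ℝ, E') ∞ B (ψ x) :=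
    contMDiffAt_of_mem_maximalAtlas hψ.codChart_mem_maximalAtlas hxB
  have hBψ : ∀ y ∈ A.source, B (ψ y) = e (A.extend I y, 0) := by
    intro y hy
    have := hw ((A.extend I).map_source (by simpa using hy))
    rwa [Function.comp_apply, Function.comp_apply, A.extend_left_inv hy] at this
  let w' : E' := mfderiv 𝓘(ℝ, E') 𝓘(ℝ, E') B (ψ x) w
  -- In adapted charts the immersion is $u\mapsto(u,0)$. If $w$ had a transverse component, a
  -- functional $c$ on the complement would give a function `C ∘ B` vanishing along the immersion
  -- but not annihilated by $w$.
  have h2 : (e.symm w').2 = 0 := by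
    by_contra hne
    obtain ⟨c, hc⟩ := SeparatingDual.exists_ne_zero (R := ℝ) hne
    apply hc
    let C : E' →L[ℝ] ℝ := c ∘L ContinuousLinearMap.snd ℝ E _ ∘L e.symm.toContinuousLinearMap
    have h3 := h (C ∘ B) (C.contMDiff.contMDiffAt.comp _ hBs) (by
      filter_upwards [A.open_source.mem_nhds hxA] with y hy
      simp [C, hBψ y hy])
    rw [mvfderiv_comp_apply _ C.mdifferentiableAt (hBs.mdifferentiableAt (by simp))] at h3
    have h4 : mvfderiv 𝓘(ℝ, E') C (B (ψ x)) w' = C w' :=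
      congrArg (fun A : E' →L[ℝ] ℝ ↦ A w') (mfderiv_eq_fderiv.trans C.fderiv)
    exact h4.symm.trans h3
  set φ := A.extend I with hφ
  have hxφ : φ x ∈ φ.target := φ.map_source (by simpa [hφ] using hxA)
  have hφt : φ.target ∈ 𝓝 (φ x) := A.isOpen_extend_target.mem_nhds hxφ
  have hφs : MDifferentiableAt 𝓘(ℝ, E) I φ.symm (φ x) := by
    have h5 := contMDiffOn_extend_symm (I := I) hψ.domChart_mem_maximalAtlas
    rw [← OpenPartialHomeomorph.extend_target'] at h5
    exact (h5.contMDiffAt hφt).mdifferentiableAt (by simp)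
  have hφx : φ.symm (φ x) = x := A.extend_left_inv hxA
  have hψd : MDifferentiableAt I 𝓘(ℝ, E') ψ x := hψ.contMDiffAt.mdifferentiableAt (by simp)
  refine ⟨mfderiv 𝓘(ℝ, E) I φ.symm (φ x) (e.symm w').1, ?_⟩
  apply hBm.mfderiv_injective hxB
  let J : E →L[ℝ] E' := e.toContinuousLinearMap ∘L ContinuousLinearMap.inl ℝ E _
  have h6 : (B ∘ ψ) ∘ φ.symm =ᶠ[𝓝 (φ x)] J := by
    filter_upwards [hφt] with z hz
    exact hw hz
  have hBψd : MDifferentiableAt I 𝓘(ℝ, E') (B ∘ ψ) x :=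
    (hBs.mdifferentiableAt (by simp)).comp x hψd
  have h7 := mfderiv_comp_apply_of_eq (φ x) hBψd hφs hφx (e.symm w').1
  have h8 := mfderiv_comp_apply x (hBs.mdifferentiableAt (by simp)) hψd
    (mfderiv 𝓘(ℝ, E) I φ.symm (φ x) (e.symm w').1)
  rw [h6.mfderiv_eq] at h7
  have h9 : mfderiv 𝓘(ℝ, E) 𝓘(ℝ, E') J (φ x) (e.symm w').1 = J (e.symm w').1 :=
    congrArg (fun A : E →L[ℝ] E' ↦ A (e.symm w').1) (mfderiv_eq_fderiv.trans J.fderiv)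
  have h10 : J (e.symm w').1 = w' := by
    have : ((e.symm w').1, 0) = e.symm w' := Prod.ext rfl h2.symm
    simp [J, this]
  exact h8.symm.trans (h7.symm.trans (h9.trans h10))
end

/-! ### Linear algebra of a Lorentzian inner product. -/

lemma sq_sum_mul_le {a₀ a₁ a₂ a₃ b₀ b₁ b₂ b₃ : ℝ} (ha : a₁ ^ 2 + a₂ ^ 2 + a₃ ^ 2 ≤ a₀ ^ 2)
    (hb : b₁ ^ 2 + b₂ ^ 2 + b₃ ^ 2 ≤ b₀ ^ 2) :
    |a₁ * b₁ + a₂ * b₂ + a₃ * b₃| ≤ |a₀ * b₀| := by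
  apply sq_le_sq.1
  have h1 : (a₁ * b₁ + a₂ * b₂ + a₃ * b₃) ^ 2
      ≤ (a₁ ^ 2 + a₂ ^ 2 + a₃ ^ 2) * (b₁ ^ 2 + b₂ ^ 2 + b₃ ^ 2) := by
    nlinarith [sq_nonneg (a₁ * b₂ - a₂ * b₁), sq_nonneg (a₁ * b₃ - a₃ * b₁),
      sq_nonneg (a₂ * b₃ - a₃ * b₂)]
  have h2 : (a₁ ^ 2 + a₂ ^ 2 + a₃ ^ 2) * (b₁ ^ 2 + b₂ ^ 2 + b₃ ^ 2) ≤ a₀ ^ 2 * b₀ ^ 2 :=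
    mul_le_mul ha hb (by positivity) (by positivity)
  rw [mul_pow]
  exact h1.trans h2

section
variable {M : Type*} [TopologicalSpace M] [ChartedSpace E4 M] [IsManifold 𝓘(ℝ, E4) ∞ M]
  (g : LorentzMetric M)

lemma LorentzMetric.exists_coordinates (p : M) : ∃ c : TS p ≃ₗ[ℝ] (Fin 4 → ℝ), ∀ v w,
    g.inner p v w = c v 0 * c w 0 - (c v 1 * c w 1 + c v 2 * c w 2 + c v 3 * c w 3) := by
  obtain ⟨b, hb⟩ := g.signature p
  refine ⟨b.equivFun, fun v w ↦ ?_⟩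
  conv_lhs => rw [← b.sum_equivFun v, ← b.sum_equivFun w]
  simp only [Fin.sum_univ_four, map_add, map_smul, add_apply, smul_apply, hb, smul_eq_mul]
  simp
  ring

lemma LorentzMetric.exists_inner_eq {p : M} (α : TS p →L[ℝ] ℝ) :
    ∃ ξ, ∀ w, g.inner p ξ w = α w := by
  obtain ⟨c, hc⟩ := g.exists_coordinates p
  let a : Fin 4 → ℝ := fun i ↦ α (c.symm (Pi.single i 1))
  refine ⟨c.symm ![a 0, - a 1, - a 2, - a 3], fun w ↦ ?_⟩
  have hw : w = ∑ i, c w i • c.symm (Pi.single i 1) := by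
    apply c.injective
    rw [map_sum]
    ext j
    simp [Finset.sum_apply, Pi.single_apply]
  rw [hc]
  conv_rhs => rw [hw]
  simp only [Fin.sum_univ_four, c.apply_symm_apply, a]
  simp
  ring

lemma LorentzMetric.eq_zero_of_forall_inner {p : M} {v : TS p} (h : ∀ w, g.inner p v w = 0) :
    v = 0 := by
  obtain ⟨c, hc⟩ := g.exists_coordinates p
  apply c.injective
  have h1 (i : Fin 4) := h (c.symm (Pi.single i 1))
  simp only [hc, c.apply_symm_apply] at h1
  ext i
  have := h1 i
  fin_cases i <;> simpa using this

/-- By Cauchy–Schwarz on the spatial parts: the orthogonal complement of a timelike vector is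
negative definite. -/
lemma LorentzMetric.eq_zero_of_orthogonal_timelike {p : M} {v τ : TS p}
    (hτ : 0 < g.inner p τ τ) (hv : 0 ≤ g.inner p v v) (h : g.inner p v τ = 0) : v = 0 := by
  obtain ⟨c, hc⟩ := g.exists_coordinates p
  rw [hc] at hτ hv h
  have hv' : c v 1 ^ 2 + c v 2 ^ 2 + c v 3 ^ 2 ≤ c v 0 ^ 2 := by nlinarith
  have hτ' : c τ 1 ^ 2 + c τ 2 ^ 2 + c τ 3 ^ 2 < c τ 0 ^ 2 := by nlinarith
  have h1 : (c v 0 * c τ 0) ^ 2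
      ≤ (c v 1 ^ 2 + c v 2 ^ 2 + c v 3 ^ 2) * (c τ 1 ^ 2 + c τ 2 ^ 2 + c τ 3 ^ 2) := by
    rw [sub_eq_zero.1 h]
    nlinarith [sq_nonneg (c v 1 * c τ 2 - c v 2 * c τ 1), sq_nonneg (c v 1 * c τ 3 - c v 3 * c τ 1),
      sq_nonneg (c v 2 * c τ 3 - c v 3 * c τ 2)]
  have h2 : (c v 0 * c τ 0) ^ 2 ≤ c v 0 ^ 2 * (c τ 1 ^ 2 + c τ 2 ^ 2 + c τ 3 ^ 2) :=
    h1.trans (mul_le_mul_of_nonneg_right hv' (by positivity))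
  have h3 : c v 0 ^ 2 = 0 := by
    by_contra hne
    have : 0 < c v 0 ^ 2 := lt_of_le_of_ne (sq_nonneg _) (Ne.symm hne)
    nlinarith
  rw [h3] at hv'
  apply c.injective
  ext i
  rw [map_zero, Pi.zero_apply, ← sq_eq_zero_iff]
  fin_cases i <;> simp only [Fin.zero_eta, Fin.mk_one, Fin.reduceFinMk] <;>
    nlinarith [sq_nonneg (c v 1), sq_nonneg (c v 2), sq_nonneg (c v 3)]

lemma LorentzMetric.exists_smul_eq_of_null {p : M} {a b τ : TS p} (hτ : 0 < g.inner p τ τ)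
    (ha : g.inner p a a = 0) (hb : g.inner p b b = 0) (hab : g.inner p a b = 0) (ha0 : a ≠ 0) :
    ∃ r : ℝ, b = r • a := by
  have haτ : g.inner p a τ ≠ 0 := fun h ↦ ha0 (g.eq_zero_of_orthogonal_timelike hτ ha.ge h)
  -- This ratio makes $b-ra$ orthogonal to the timelike vector; $b-ra$ is also null, hence zero.
  refine ⟨g.inner p b τ / g.inner p a τ, ?_⟩
  rw [← sub_eq_zero]
  have hba : g.inner p b a = 0 := by rw [g.symm, hab]
  apply g.eq_zero_of_orthogonal_timelike hτ
  · simp [ha, hb, hab, hba]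
  · simp [haτ]

lemma LorentzMetric.inner_nonneg_of_futurePointing {τ : TimeOrientation g} {p : M} {a b : TS p}
    (ha : FuturePointing g τ p a) (hb : FuturePointing g τ p b) : 0 ≤ g.inner p a b := by
  obtain ⟨c, hc⟩ := g.exists_coordinates p
  have hτ := τ.timelike p
  obtain ⟨ha, haτ⟩ := ha
  obtain ⟨hb, hbτ⟩ := hb
  rw [hc] at *
  set t : TS p := τ.field p
  have ha' : c a 1 ^ 2 + c a 2 ^ 2 + c a 3 ^ 2 ≤ c a 0 ^ 2 := by nlinarith
  have hb' : c b 1 ^ 2 + c b 2 ^ 2 + c b 3 ^ 2 ≤ c b 0 ^ 2 := by nlinarith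
  have hτ' : c t 1 ^ 2 + c t 2 ^ 2 + c t 3 ^ 2 ≤ c t 0 ^ 2 := by nlinarith
  have hat := sq_sum_mul_le ha' hτ'
  have hbt := sq_sum_mul_le hb' hτ'
  have hab := sq_sum_mul_le ha' hb'
  have h1 : 0 < c a 0 * c t 0 := by
    by_contra hneg
    rw [abs_of_nonpos (not_lt.1 hneg)] at hat
    linarith [neg_le_abs (c a 1 * c t 1 + c a 2 * c t 2 + c a 3 * c t 3)]
  have h2 : 0 < c b 0 * c t 0 := by
    by_contra hneg
    rw [abs_of_nonpos (not_lt.1 hneg)] at hbt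
    linarith [neg_le_abs (c b 1 * c t 1 + c b 2 * c t 2 + c b 3 * c t 3)]
  have h3 : 0 < c a 0 * c b 0 := by
    have h4 : 0 < (c a 0 * c b 0) * c t 0 ^ 2 := by nlinarith [mul_pos h1 h2]
    exact pos_of_mul_pos_left h4 (sq_nonneg _)
  rw [abs_of_pos h3] at hab
  linarith [le_abs_self (c a 1 * c b 1 + c a 2 * c b 2 + c a 3 * c b 3)]

end

/-! ### Null tetrads, traces and the expansion. -/

section
variable {M : Type*} [TopologicalSpace M] [ChartedSpace E4 M] [IsManifold 𝓘(ℝ, E4) ∞ M]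
  {g : LorentzMetric M} {p : M}

namespace NullTetrad
variable (t : NullTetrad g p)

lemma inner_l_x : g.inner p t.l t.m.1 = 0 := by
  simpa [innerC] using congrArg Complex.re t.l_m

lemma inner_l_y : g.inner p t.l t.m.2 = 0 := by
  simpa [innerC] using congrArg Complex.im t.l_m

lemma inner_n_x : g.inner p t.n t.m.1 = 0 := by
  simpa [innerC] using congrArg Complex.re t.n_m

lemma inner_n_y : g.inner p t.n t.m.2 = 0 := by
  simpa [innerC] using congrArg Complex.im t.n_m

lemma inner_x_x : g.inner p t.m.1 t.m.1 = -(1 / 2) := by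
  have h1 := congrArg Complex.re t.m_m
  have h2 := congrArg Complex.re t.m_conj
  simp [innerC, conjV] at h1 h2
  linarith

lemma inner_y_y : g.inner p t.m.2 t.m.2 = -(1 / 2) := by
  have h1 := congrArg Complex.re t.m_m
  have h2 := congrArg Complex.re t.m_conj
  simp [innerC, conjV] at h1 h2
  linarith

lemma inner_x_y : g.inner p t.m.1 t.m.2 = 0 := by
  have h1 := congrArg Complex.im t.m_m
  simp [innerC, g.symm p t.m.2 t.m.1] at h1
  linarith

lemma inner_n_l : g.inner p t.n t.l = 1 := by rw [g.symm, t.l_n]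
lemma inner_x_l : g.inner p t.m.1 t.l = 0 := by rw [g.symm, t.inner_l_x]
lemma inner_y_l : g.inner p t.m.2 t.l = 0 := by rw [g.symm, t.inner_l_y]
lemma inner_x_n : g.inner p t.m.1 t.n = 0 := by rw [g.symm, t.inner_n_x]
lemma inner_y_n : g.inner p t.m.2 t.n = 0 := by rw [g.symm, t.inner_n_y]
lemma inner_y_x : g.inner p t.m.2 t.m.1 = 0 := by rw [g.symm, t.inner_x_y]

lemma span_eq_top : Submodule.span ℝ (range ![t.l, t.n, t.m.1, t.m.2]) = ⊤ := by
  have : FiniteDimensional ℝ (TS p) := (coordBasis p).finiteDimensional_of_finite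
  apply LinearIndependent.span_eq_top_of_card_eq_finrank'
  · rw [Fintype.linearIndependent_iff]
    intro a ha
    simp only [Fin.sum_univ_four, Matrix.cons_val_zero, Matrix.cons_val_one, Matrix.cons_val] at ha
    have h (w : TS p) := congrArg (fun v ↦ g.inner p v w) ha
    have hl := h t.l
    have hn := h t.n
    have hx := h t.m.1
    have hy := h t.m.2
    simp [t.l_l, t.n_n, t.l_n, t.inner_l_x, t.inner_l_y, t.inner_n_x, t.inner_n_y, t.inner_x_x,
      t.inner_y_y, t.inner_x_y, t.inner_n_l, t.inner_x_l, t.inner_y_l, t.inner_x_n, t.inner_y_n,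
      t.inner_y_x] at hl hn hx hy
    intro i
    fin_cases i <;> assumption
  · have : Module.finrank ℝ (TS p) = 4 := by
      rw [Module.finrank_eq_card_basis (coordBasis p), Fintype.card_fin]
    rw [this, Fintype.card_fin]

lemma eq_zero_of_orthogonal {u : TS p} (hl : g.inner p u t.l = 0) (hn : g.inner p u t.n = 0)
    (hx : g.inner p u t.m.1 = 0) (hy : g.inner p u t.m.2 = 0) : u = 0 := by
  apply g.eq_zero_of_forall_inner
  intro w
  have hw : w ∈ Submodule.span ℝ (range ![t.l, t.n, t.m.1, t.m.2]) := by
    rw [t.span_eq_top]; trivial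
  induction hw using Submodule.span_induction with
  | mem w hw =>
    obtain ⟨i, rfl⟩ := hw
    fin_cases i <;> assumption
  | zero => simp
  | add v w _ _ hv hw => rw [map_add, hv, hw, add_zero]
  | smul a v _ hv => rw [map_smul, hv, smul_zero]

lemma expand (v : TS p) : v = g.inner p v t.n • t.l + g.inner p v t.l • t.n
    + (-2 * g.inner p v t.m.1) • t.m.1 + (-2 * g.inner p v t.m.2) • t.m.2 := by
  rw [← sub_eq_zero]
  apply t.eq_zero_of_orthogonal <;>
    simp [t.l_l, t.n_n, t.l_n, t.inner_l_x, t.inner_l_y, t.inner_n_x, t.inner_n_y, t.inner_x_x,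
      t.inner_y_y, t.inner_x_y, t.inner_n_l, t.inner_x_l, t.inner_y_l, t.inner_x_n, t.inner_y_n,
      t.inner_y_x] <;> ring

/-- The basis dual to $(l,n,x,y)$ under $g$ is $(n,l,-2x,-2y)$, since $x$ and $y$ have square
$-\tfrac12$; the trace does not depend on the basis. -/
lemma sum_repr_eq (A : TS p →ₗ[ℝ] TS p) : ∑ i, (coordBasis p).repr (A (coordBasis p i)) i
    = g.inner p (A t.l) t.n + g.inner p (A t.n) t.l - 2 * g.inner p (A t.m.1) t.m.1
      - 2 * g.inner p (A t.m.2) t.m.2 := by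
  have h (u w : TS p) : ∑ i, g.inner p (coordBasis p i) w * (coordBasis p).repr u i
      = g.inner p u w := by
    conv_rhs => rw [← (coordBasis p).sum_repr u]
    simp only [Fin.sum_univ_four, map_add, map_smul, add_apply, smul_apply, smul_eq_mul]
    ring
  rw [← h, ← h, ← h, ← h, Finset.mul_sum, Finset.mul_sum, ← Finset.sum_add_distrib,
    ← Finset.sum_sub_distrib, ← Finset.sum_sub_distrib]
  refine Finset.sum_congr rfl fun i _ ↦ ?_
  conv_lhs => rw [t.expand (coordBasis p i)]
  simp only [map_add, map_smul, Finsupp.add_apply, Finsupp.smul_apply, smul_eq_mul]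
  ring

end NullTetrad

lemma expansion_eq (D : Connection M) (l : Π p : M, TangentSpace 𝓘(ℝ, E4) p) (t : NullTetrad g p) :
    expansion g D l t
      = -2 * (g.inner p (D l p t.m.1) t.m.1 + g.inner p (D l p t.m.2) t.m.2) := by
  simp [expansion, innerC, covC, conjV]
  ring

/-- Gram–Schmidt on $E,F$ supplies $m$. The explicit norms of $\alpha,\beta$ are recorded so that
the expansion can be rewritten in terms of $E,F$. -/
lemma exists_nullTetrad {l k E F : TS p} (hl : g.inner p l l = 0) (hk : g.inner p k l ≠ 0)
    (hE : g.inner p E l = 0) (hF : g.inner p F l = 0) (hEE : g.inner p E E < 0)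
    (hEF : 0 < g.inner p E E * g.inner p F F - g.inner p E F ^ 2) :
    ∃ (t : NullTetrad g p) (α β : ℝ), t.l = l ∧ t.m.1 = α • E ∧
      t.m.2 = β • (g.inner p E E • F - g.inner p E F • E) ∧
      -2 * g.inner p E E * α ^ 2 = 1 ∧
      -2 * g.inner p E E * (g.inner p E E * g.inner p F F - g.inner p E F ^ 2) * β ^ 2 = 1 := by
  set a := g.inner p E E with ha
  set b := g.inner p E F with hb
  set c := g.inner p F F with hc
  set d := a * c - b ^ 2 with hd
  have hlE : g.inner p l E = 0 := by rw [g.symm, hE]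
  have hlF : g.inner p l F = 0 := by rw [g.symm, hF]
  have hba : g.inner p F E = b := by rw [g.symm]
  -- The component of $k$ orthogonal to $E$ and $F$, with coefficients from Cramer's rule for their
  -- Gram matrix.
  set n₀ : TS p := k + ((g.inner p k F * b - g.inner p k E * c) / d) • E
    + ((g.inner p k E * b - g.inner p k F * a) / d) • F with hn₀
  have hn₀E : g.inner p n₀ E = 0 := by
    simp only [hn₀, map_add, map_smul, add_apply, smul_apply, smul_eq_mul, ← ha, hba]
    field_simp
    rw [hd]; ring
  have hn₀F : g.inner p n₀ F = 0 := by
    simp only [hn₀, map_add, map_smul, add_apply, smul_apply, smul_eq_mul, ← hb, ← hc]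
    field_simp
    rw [hd]; ring
  have hn₀l : g.inner p n₀ l = g.inner p k l := by
    simp [hn₀, hE, hF]
  set r := g.inner p k l with hr
  -- Scaling gives $g(l,n)=1$; the multiple of $l$ then makes $n$ null without disturbing the other
  -- products.
  set n : TS p := (1 / r) • n₀ - (g.inner p n₀ n₀ / (2 * r ^ 2)) • l with hn
  have hln₀ : g.inner p l n₀ = r := by rw [g.symm, hn₀l]
  have hsqrt {y : ℝ} (hy : 0 < y) : ∃ z : ℝ, y * z ^ 2 = 1 :=
    ⟨(√y)⁻¹, by rw [inv_pow, Real.sq_sqrt hy.le, mul_inv_cancel₀ hy.ne']⟩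
  have hpos : 0 < -2 * a := by linarith
  obtain ⟨α, hα⟩ := hsqrt hpos
  obtain ⟨β, hβ⟩ := hsqrt (mul_pos hpos hEF)
  refine ⟨⟨l, n, (α • E, β • (a • F - b • E)), hl, ?_, ?_, ?_, ?_, ?_, ?_⟩, α, β, rfl, rfl, rfl,
    hα, hβ⟩
  · simp [hn, hl, hln₀, hn₀l]
    field_simp
    ring
  · simp [hn, hl, hln₀, hk]
  · apply Complex.ext
    · simp only [innerC, map_sub, map_smul, sub_apply, smul_apply, smul_eq_mul, ← ha, ← hb, ← hc,
        hba, Complex.zero_re]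
      linear_combination (-1 / 2 : ℝ) * hα + (1 / 2 : ℝ) * hβ
    · simp only [innerC, map_sub, map_smul, sub_apply, smul_apply, smul_eq_mul, ← ha, ← hb, ← hc,
        hba, Complex.zero_im]
      ring
  · apply Complex.ext
    · simp only [innerC, conjV, map_sub, map_neg, map_smul, sub_apply, smul_apply, smul_eq_mul,
        ← ha, ← hb, ← hc, hba, Complex.neg_re, Complex.one_re]
      linear_combination (-1 / 2 : ℝ) * hα - (1 / 2 : ℝ) * hβ
    · simp only [innerC, conjV, map_sub, map_neg, map_smul, sub_apply, smul_apply, smul_eq_mul,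
        ← ha, ← hb, ← hc, hba, Complex.neg_im, Complex.one_im]
      ring
  · simp [innerC, hlE, hlF]
    rfl
  · simp [innerC, hn, hlE, hlF, hn₀E, hn₀F]
    rfl

/-- The left side is the trace of $B$ over the span of $E,F$, multiplied by the Gram determinant.
Clearing the denominator and avoiding square roots leaves an expression that is easy to
differentiate. -/
lemma screen_trace_eq_zero {D : Connection M} {l : Π p : M, TangentSpace 𝓘(ℝ, E4) p} {k E F : TS p}
    (hl : g.inner p (l p) (l p) = 0) (hk : g.inner p k (l p) ≠ 0)
    (hE : g.inner p E (l p) = 0) (hF : g.inner p F (l p) = 0) (hEE : g.inner p E E < 0)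
    (hEF : 0 < g.inner p E E * g.inner p F F - g.inner p E F ^ 2)
    (hθ : ∀ t : NullTetrad g p, t.l = l p → expansion g D l t = 0) :
    g.inner p F F * g.inner p (D l p E) E
      - g.inner p E F * (g.inner p (D l p E) F + g.inner p (D l p F) E)
      + g.inner p E E * g.inner p (D l p F) F = 0 := by
  obtain ⟨t, α, β, htl, hx, hy, hα, hβ⟩ := exists_nullTetrad hl hk hE hF hEE hEF
  have h := hθ t htl
  rw [expansion_eq, hx, hy] at h
  simp only [map_sub, map_smul, sub_apply, smul_apply, smul_eq_mul] at h
  set a := g.inner p E E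
  set b := g.inner p E F
  set c := g.inner p F F
  have hβ' : -2 * a * β ^ 2 * (a * c - b ^ 2) = 1 := by linarith
  have hα' : α ^ 2 = (a * c - b ^ 2) * β ^ 2 := by
    have h1 : (-2 * a) * (α ^ 2 - (a * c - b ^ 2) * β ^ 2) = 0 := by linarith
    have h2 := (mul_eq_zero.1 h1).resolve_left (by linarith)
    linarith
  have hβ0 : β ^ 2 ≠ 0 := by
    intro h0
    rw [h0] at hβ'
    simp at hβ'
  have h3 : -2 * a * β ^ 2 * (c * g.inner p (D l p E) E
      - b * (g.inner p (D l p E) F + g.inner p (D l p F) E) + a * g.inner p (D l p F) F) = 0 := by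
    linear_combination h + 2 * g.inner p (D l p E) E * hα'
  exact (mul_eq_zero.1 h3).resolve_left (mul_ne_zero (by linarith) hβ0)

end

/-! ### Smoothness of vector fields and of their covariant derivatives. -/

section
variable {M : Type*} [TopologicalSpace M] [ChartedSpace E4 M] [IsManifold 𝓘(ℝ, E4) ∞ M]
  {g : LorentzMetric M} {D : Connection M} {p : M}

/-- The vector field `X` is differentiable at `p`. -/
abbrev VFDifferentiableAt (X : Π q : M, TangentSpace 𝓘(ℝ, E4) q) (p : M) : Prop :=
  MDifferentiableAt 𝓘(ℝ, E4) (𝓘(ℝ, E4).prod 𝓘(ℝ, E4)) (asSection X) p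

/-- The vector field `X` is smooth in a neighbourhood of `p`. -/
def VFSmoothNear (X : Π q : M, TangentSpace 𝓘(ℝ, E4) q) (p : M) : Prop :=
  ∀ᶠ q in 𝓝 p, ContMDiffAt 𝓘(ℝ, E4) (𝓘(ℝ, E4).prod 𝓘(ℝ, E4)) ∞ (asSection X) q

namespace VFSmoothNear
variable {X Y : Π q : M, TangentSpace 𝓘(ℝ, E4) q}

lemma eventually (h : VFSmoothNear X p) : ∀ᶠ q in 𝓝 p, VFSmoothNear X q :=
  eventually_eventually_nhds.2 h

lemma differentiableAt (h : VFSmoothNear X p) : VFDifferentiableAt X p :=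
  h.self_of_nhds.mdifferentiableAt (by simp)

lemma of_contMDiffOn {U : Set M} (hU : IsOpen U) (hp : p ∈ U)
    (h : ContMDiffOn 𝓘(ℝ, E4) (𝓘(ℝ, E4).prod 𝓘(ℝ, E4)) ∞ (asSection X) U) : VFSmoothNear X p := by
  filter_upwards [hU.mem_nhds hp] with q hq
  exact h.contMDiffAt (hU.mem_nhds hq)

lemma extend (v : TS p) : VFSmoothNear (FiberBundle.extend E4 v) p := by
  obtain ⟨s, hs, h⟩ := FiberBundle.exists_contMDiffOn_extend 𝓘(ℝ, E4) E4 (k := ∞) v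
  filter_upwards [eventually_mem_nhds_iff.2 hs] with q hq
  exact h.contMDiffAt hq

lemma sub (hX : VFSmoothNear X p) (hY : VFSmoothNear Y p) : VFSmoothNear (X - Y) p := by
  filter_upwards [hX, hY] with q h1 h2
  exact ContMDiffAt.sub_section h1 h2

lemma smul {f : M → ℝ} (hf : ∀ᶠ q in 𝓝 p, ContMDiffAt 𝓘(ℝ, E4) 𝓘(ℝ, ℝ) ∞ f q)
    (hX : VFSmoothNear X p) : VFSmoothNear (f • X) p := by
  filter_upwards [hf, hX] with q h1 h2
  exact ContMDiffAt.smul_section h1 h2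

lemma contMDiffAt_inner (g : LorentzMetric M)
    (hX : ContMDiffAt 𝓘(ℝ, E4) (𝓘(ℝ, E4).prod 𝓘(ℝ, E4)) ∞ (asSection X) p)
    (hY : ContMDiffAt 𝓘(ℝ, E4) (𝓘(ℝ, E4).prod 𝓘(ℝ, E4)) ∞ (asSection Y) p) :
    ContMDiffAt 𝓘(ℝ, E4) 𝓘(ℝ, ℝ) ∞ (fun q ↦ g.inner q (X q) (Y q)) p := by
  have h : ContMDiffAt 𝓘(ℝ, E4) (𝓘(ℝ, E4).prod 𝓘(ℝ)) ∞ (fun q ↦ Bundle.TotalSpace.mk' ℝ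
      (E := Bundle.Trivial M ℝ) q (g.inner q (X q) (Y q))) p :=
    ContMDiffAt.clm_bundle_apply₂ (F₁ := E4) (F₂ := E4) g.contMDiff.contMDiffAt hX hY
  rw [Bundle.contMDiffAt_totalSpace] at h
  exact h.2

lemma inner (g : LorentzMetric M) (hX : VFSmoothNear X p) (hY : VFSmoothNear Y p) :
    ∀ᶠ q in 𝓝 p, ContMDiffAt 𝓘(ℝ, E4) 𝓘(ℝ, ℝ) ∞ (fun q ↦ g.inner q (X q) (Y q)) q := by
  filter_upwards [hX, hY] with q h1 h2
  exact contMDiffAt_inner g h1 h2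

/-- Smoothness of the connection is given over open sets, so $X$ must be smooth on a full
neighbourhood, not merely at $p$. -/
lemma contMDiffAt_cov (hD : IsLeviCivita g D) (hX : VFSmoothNear X p) :
    ∀ᶠ q in 𝓝 p, ContMDiffAt 𝓘(ℝ, E4) (𝓘(ℝ, E4).prod 𝓘(ℝ, E4 →L[ℝ] E4)) ∞
      (fun q ↦ Bundle.TotalSpace.mk' (E4 →L[ℝ] E4) (E := fun q : M ↦ TS q →L[ℝ] TS q) q (D X q)) q := by
  obtain ⟨U, hU, hUo, hpU⟩ := eventually_nhds_iff.1 hX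
  have := (hD.smooth U hUo).contMDiff (σ := X) (fun q hq ↦ (hU q hq).contMDiffWithinAt)
  filter_upwards [hUo.mem_nhds hpU] with q hq
  exact this.contMDiffAt (hUo.mem_nhds hq)

lemma cov (hD : IsLeviCivita g D) (hX : VFSmoothNear X p) (hY : VFSmoothNear Y p) :
    VFSmoothNear (fun q ↦ D X q (Y q)) p := by
  filter_upwards [hX.contMDiffAt_cov hD, hY] with q h1 h2
  exact h1.clm_bundle_apply h2

lemma differentiableAt_cov (hD : IsLeviCivita g D) (hX : VFSmoothNear X p)
    (hY : VFDifferentiableAt Y p) : VFDifferentiableAt (fun q ↦ D X q (Y q)) p :=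
  ((hX.contMDiffAt_cov hD).self_of_nhds.mdifferentiableAt (by simp)).clm_bundle_apply hY

end VFSmoothNear
end

/-! ### Curvature as a tensor, its skew symmetry, and the Ricci trace in a tetrad. -/

section
variable {M : Type*} [TopologicalSpace M] [ChartedSpace E4 M] [IsManifold 𝓘(ℝ, E4) ∞ M]
  {g : LorentzMetric M} {D : Connection M} {p : M}
  {X Y Z W : Π q : M, TangentSpace 𝓘(ℝ, E4) q}

lemma IsLeviCivita.mlieBracket_eq (hD : IsLeviCivita g D) (hX : VFDifferentiableAt X p)
    (hY : VFDifferentiableAt Y p) :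
    mlieBracket 𝓘(ℝ, E4) X Y p = D Y p (X p) - D X p (Y p) :=
  ((CovariantDerivative.torsion_eq_zero_iff D).1 hD.torsion_free hX hY).symm

lemma cov_smul_apply (D : Connection M) {f : M → ℝ} (hX : VFDifferentiableAt X p)
    (hf : MDifferentiableAt 𝓘(ℝ, E4) 𝓘(ℝ, ℝ) f p) (v : TS p) :
    D (f • X) p v = f p • D X p v + mvfderiv 𝓘(ℝ, E4) f p v • X p := by
  rw [D.isCovariantDerivativeOnUniv.leibniz hX hf]
  rfl

lemma cov_add_apply (D : Connection M) (hX : VFDifferentiableAt X p)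
    (hY : VFDifferentiableAt Y p) (v : TS p) :
    D (X + Y) p v = D X p v + D Y p v := by
  rw [D.isCovariantDerivativeOnUniv.add hX hY]
  rfl

/-- The curvature operator `R(X,Y)Z` of vector fields, at the point `p`. -/
def curvatureVF (D : Connection M) (X Y Z : Π q : M, TangentSpace 𝓘(ℝ, E4) q) (p : M) : TS p :=
  D (fun q ↦ D Z q (Y q)) p (X p) - D (fun q ↦ D Z q (X q)) p (Y p)
    - D Z p (mlieBracket 𝓘(ℝ, E4) X Y p)

lemma curvatureVF_swap (X Y Z : Π q : M, TangentSpace 𝓘(ℝ, E4) q) :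
    curvatureVF D X Y Z p = - curvatureVF D Y X Z p := by
  rw [curvatureVF, curvatureVF, mlieBracket_swap_apply, map_neg]
  abel

lemma tensorialAt_curvatureVF_left (hD : IsLeviCivita g D) (hZ : VFSmoothNear Z p) :
    TensorialAt 𝓘(ℝ, E4) E4 (fun X ↦ curvatureVF D X Y Z p) p where
  smul {f X} hf hX := by
    have h1 : (fun q ↦ D Z q ((f • X) q)) = f • fun q ↦ D Z q (X q) := by
      ext q : 1
      exact map_smul (D Z q) (f q) (X q)
    simp only [curvatureVF]
    rw [h1, cov_smul_apply D (hZ.differentiableAt_cov hD hX) hf, mlieBracket_smul_left hf hX]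
    simp only [Pi.smul_apply', map_smul, map_add]
    module
  add {X X'} hX hX' := by
    have h1 : (fun q ↦ D Z q ((X + X') q)) = (fun q ↦ D Z q (X q)) + fun q ↦ D Z q (X' q) := by
      ext q : 1
      exact map_add (D Z q) (X q) (X' q)
    simp only [curvatureVF]
    rw [h1, cov_add_apply D (hZ.differentiableAt_cov hD hX) (hZ.differentiableAt_cov hD hX'),
      mlieBracket_add_left hX hX']
    simp only [Pi.add_apply, map_add]
    module

lemma tensorialAt_curvatureVF_right (hD : IsLeviCivita g D) (hZ : VFSmoothNear Z p) :
    TensorialAt 𝓘(ℝ, E4) E4 (fun Y ↦ curvatureVF D X Y Z p) p where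
  smul hf hY := by
    simp only [curvatureVF_swap X]
    rw [(tensorialAt_curvatureVF_left hD hZ).smul hf hY, smul_neg]
  add hY hY' := by
    simp only [curvatureVF_swap X]
    rw [(tensorialAt_curvatureVF_left hD hZ).add hY hY', neg_add]

lemma IsLeviCivita.mvfderiv_mvfderiv_inner (hD : IsLeviCivita g D) (hX : VFSmoothNear X p)
    (hZ : VFSmoothNear Z p) (hW : VFSmoothNear W p) (v : TS p) :
    mvfderiv 𝓘(ℝ, E4) (fun q ↦ mvfderiv 𝓘(ℝ, E4) (fun q ↦ g.inner q (Z q) (W q)) q (X q)) p v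
      = g.inner p (D (fun q ↦ D Z q (X q)) p v) (W p) + g.inner p (D Z p (X p)) (D W p v)
        + (g.inner p (D Z p v) (D W p (X p)) + g.inner p (Z p) (D (fun q ↦ D W q (X q)) p v)) := by
  have h1 : (fun q ↦ mvfderiv 𝓘(ℝ, E4) (fun q ↦ g.inner q (Z q) (W q)) q (X q)) =ᶠ[𝓝 p]
      (fun q ↦ g.inner q (D Z q (X q)) (W q)) + fun q ↦ g.inner q (Z q) (D W q (X q)) := by
    filter_upwards [hZ.eventually, hW.eventually] with q h1 h2
    exact hD.metric q Z W h1.differentiableAt h2.differentiableAt (X q)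
  rw [mvfderiv_congr_of_eventuallyEq h1, mvfderiv_add
    (((hZ.cov hD hX).inner g hW).self_of_nhds.mdifferentiableAt (by simp))
    ((hZ.inner g (hW.cov hD hX)).self_of_nhds.mdifferentiableAt (by simp)), add_apply,
    hD.metric p _ W (hZ.cov hD hX).differentiableAt hW.differentiableAt,
    hD.metric p Z _ hZ.differentiableAt (hW.cov hD hX).differentiableAt]

/-- Apply $XY-YX-[X,Y]=0$ to the function $g(Z,W)$; the mixed first-order terms cancel. -/
lemma IsLeviCivita.inner_curvatureVF (hD : IsLeviCivita g D) (hX : VFSmoothNear X p)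
    (hY : VFSmoothNear Y p) (hZ : VFSmoothNear Z p) (hW : VFSmoothNear W p) :
    g.inner p (curvatureVF D X Y Z p) (W p) = - g.inner p (Z p) (curvatureVF D X Y W p) := by
  have h := mvfderiv_mvfderiv_apply_sub ((hZ.inner g hW).self_of_nhds.of_le ENat.LEInfty.out)
    hX.differentiableAt hY.differentiableAt
  rw [hD.mvfderiv_mvfderiv_inner hY hZ hW, hD.mvfderiv_mvfderiv_inner hX hZ hW,
    hD.metric p Z W hZ.differentiableAt hW.differentiableAt] at h
  simp only [curvatureVF, map_sub, sub_apply]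
  linear_combination h

/-- Independence of the extension of $Z$ comes from skew symmetry rather than a Leibniz computation:
$-g(Z,R(X,Y)W)$ sees only the value of $Z$ at $p$. In $X$ and $Y$ the operator is tensorial. -/
lemma IsLeviCivita.curvature_eq (hD : IsLeviCivita g D) (hX : VFSmoothNear X p)
    (hY : VFSmoothNear Y p) (hZ : VFSmoothNear Z p) :
    curvature D p (X p) (Y p) (Z p) = curvatureVF D X Y Z p := by
  have hc : curvature D p (X p) (Y p) (Z p) = curvatureVF D (FiberBundle.extend E4 (X p))
      (FiberBundle.extend E4 (Y p)) (FiberBundle.extend E4 (Z p)) p := by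
    simp [curvature, curvatureVF]
  rw [hc, ← sub_eq_zero]
  apply g.eq_zero_of_forall_inner
  intro w
  have hX' := VFSmoothNear.extend (X p)
  have hY' := VFSmoothNear.extend (Y p)
  have hZ' := VFSmoothNear.extend (Z p)
  have hW' := VFSmoothNear.extend w
  have h1 := hD.inner_curvatureVF hX' hY' hZ' hW'
  have h2 := hD.inner_curvatureVF hX hY hZ hW'
  have h3 := TensorialAt.pointwise₂
    (Φ := fun X Y ↦ curvatureVF D X Y (FiberBundle.extend E4 w) p)
    (fun _ _ ↦ tensorialAt_curvatureVF_left hD hW')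
    (fun _ _ ↦ tensorialAt_curvatureVF_right hD hW')
    hX'.differentiableAt hX.differentiableAt hY'.differentiableAt hY.differentiableAt
    (by simp) (by simp)
  rw [h3] at h1
  simp only [FiberBundle.extend_apply_self] at h1 h2
  rw [map_sub, sub_apply, h1, h2, sub_self]

lemma IsLeviCivita.ricci_eq (hD : IsLeviCivita g D) (t : NullTetrad g p) (u : TS p) :
    ricci D p u u = g.inner p (curvature D p u t.l u) t.n + g.inner p (curvature D p u t.n u) t.l
      - 2 * g.inner p (curvature D p u t.m.1 u) t.m.1
      - 2 * g.inner p (curvature D p u t.m.2 u) t.m.2 := by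
  have hu := VFSmoothNear.extend u
  -- Since `curvature` is defined by extending vectors, its linearity in the middle slot has to come
  -- from tensoriality before the trace formula applies.
  let A : TS p →L[ℝ] TS p := TensorialAt.mkHom _ p
    (tensorialAt_curvatureVF_right (X := FiberBundle.extend E4 u) hD hu)
  have hA (v : TS p) : A v = curvature D p u v u := by
    simp [A, TensorialAt.mkHom_apply_eq_extend, curvature, curvatureVF]
  have := t.sum_repr_eq A.toLinearMap
  simpa [hA, ricci] using this

lemma IsLeviCivita.inner_curvature_self (hD : IsLeviCivita g D) (u v w : TS p) :
    g.inner p (curvature D p u v w) w = 0 := by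
  have h := hD.inner_curvatureVF (VFSmoothNear.extend u) (VFSmoothNear.extend v)
    (VFSmoothNear.extend w) (VFSmoothNear.extend w)
  rw [← hD.curvature_eq (VFSmoothNear.extend u) (VFSmoothNear.extend v)
    (VFSmoothNear.extend w)] at h
  simp only [FiberBundle.extend_apply_self] at h
  rw [g.symm p w] at h
  linarith

lemma curvature_self (D : Connection M) (u w : TS p) : curvature D p u u w = 0 := by
  simp [curvature]

end

/-! ### Tangency to a null hypersurface and symmetry of its second fundamental form. -/

section
variable {M : Type*} [TopologicalSpace M] [ChartedSpace E4 M] [IsManifold 𝓘(ℝ, E4) ∞ M]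
  {g : LorentzMetric M} {D : Connection M}

/-- Any extension is corrected by a multiple of a field transverse to the orthogonal complement of
$l$. Nullity of $l$ plays no role, so this works off the hypersurface too. -/
lemma exists_extend_orthogonal {p : M} {l : Π q : M, TangentSpace 𝓘(ℝ, E4) q}
    (hl : VFSmoothNear l p) (hl0 : l p ≠ 0) {v : TS p} (hv : g.inner p v (l p) = 0) :
    ∃ X : Π q : M, TangentSpace 𝓘(ℝ, E4) q, VFSmoothNear X p ∧ X p = v ∧
      ∀ᶠ q in 𝓝 p, g.inner q (X q) (l q) = 0 := by
  obtain ⟨k, hk⟩ : ∃ k, g.inner p k (l p) ≠ 0 := by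
    by_contra! h
    exact hl0 (g.eq_zero_of_forall_inner fun w ↦ by rw [g.symm, h])
  have hK := VFSmoothNear.extend k
  have hV := VFSmoothNear.extend v
  have hKl := hK.inner g hl
  have hne : ∀ᶠ q in 𝓝 p, g.inner q (FiberBundle.extend E4 k q) (l q) ≠ 0 := by
    apply hKl.self_of_nhds.continuousAt.eventually_ne
    simpa using hk
  refine ⟨FiberBundle.extend E4 v - (fun q ↦ g.inner q (FiberBundle.extend E4 v q) (l q)
    / g.inner q (FiberBundle.extend E4 k q) (l q)) • FiberBundle.extend E4 k, hV.sub (.smul ?_ hK),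
    ?_, ?_⟩
  · filter_upwards [hKl, hV.inner g hl, hne] with q h1 h2 h3
    exact h2.div₀ h1 h3
  · simp [hv]
  · filter_upwards [hne] with q h
    simp [h]

lemma IsLeviCivita.inner_cov_add_eq_zero (hD : IsLeviCivita g D) {p : M}
    {Z l : Π q : M, TangentSpace 𝓘(ℝ, E4) q} (hZ : VFSmoothNear Z p) (hl : VFSmoothNear l p)
    (hZl : ∀ᶠ q in 𝓝 p, g.inner q (Z q) (l q) = 0) (u : TS p) :
    g.inner p (D Z p u) (l p) + g.inner p (Z p) (D l p u) = 0 := by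
  rw [← hD.metric _ Z l hZ.differentiableAt hl.differentiableAt]
  have : (fun q ↦ g.inner q (Z q) (l q)) =ᶠ[𝓝 p] fun _ ↦ 0 := hZl
  rw [mvfderiv_congr_of_eventuallyEq this, mvfderiv_const, zero_apply]

variable {ψ : Cylinder → M} {U : Set M} {l : Π q : M, TangentSpace 𝓘(ℝ, E4) q}

lemma IsNullNormalOn.smoothNear (hl : IsNullNormalOn g ψ U l) {x : Cylinder} (hx : ψ x ∈ U) :
    VFSmoothNear l (ψ x) :=
  .of_contMDiffOn hl.isOpen hx hl.smooth

namespace IsNullHypersurface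
variable (h : IsNullHypersurface g ψ)
include h

lemma eventually {x : Cylinder} {P : M → Prop} (hP : ∀ᶠ q in 𝓝 (ψ x), P q) :
    ∀ᶠ y in 𝓝 x, P (ψ y) :=
  h.embedding.contMDiff.continuous.continuousAt.eventually hP

lemma inner_self (hl : IsNullNormalOn g ψ U l) {x : Cylinder} (hx : ψ x ∈ U) :
    g.inner (ψ x) (l (ψ x)) (l (ψ x)) = 0 :=
  h.null x _ (hl.normal x hx)

lemma isTangent_of_inner_eq_zero (τ : TimeOrientation g) (hl : IsNullNormalOn g ψ U l)
    {x : Cylinder} (hx : ψ x ∈ U) {w : TS (ψ x)} (hw : g.inner (ψ x) w (l (ψ x)) = 0) :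
    IsTangent ψ x w := by
  refine mem_range_mfderiv_of_forall_mvfderiv_eq_zero (h.embedding.isImmersion.isImmersionAt x)
    fun f hf h0 ↦ ?_
  have hψ : MDifferentiableAt cylModel 𝓘(ℝ, E4) ψ x :=
    h.embedding.contMDiff.contMDiffAt.mdifferentiableAt (by simp)
  obtain ⟨ξ, hξ⟩ := g.exists_inner_eq (mvfderiv 𝓘(ℝ, E4) f (ψ x))
  have hξn : IsNormal g ψ x ξ := by
    rintro v ⟨u, rfl⟩
    rw [hξ]
    exact mvfderiv_mfderiv_eq_zero hψ (hf.mdifferentiableAt (by simp)) h0 u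
  have hln := hl.normal x hx
  -- Nullity of $l$, $\xi$ and $l+\xi$ polarizes to $g(l,\xi)=0$, so the gradient $\xi$ is a
  -- multiple of $l$ and annihilates $w$.
  have hsum : IsNormal g ψ x (l (ψ x) + ξ) := fun v hv ↦ by
    rw [map_add, add_apply, hln v hv, hξn v hv, add_zero]
  have h1 := h.null x _ hsum
  have h2 := h.null x _ hξn
  have h3 := h.null x _ hln
  simp only [map_add, add_apply] at h1
  rw [g.symm _ ξ (l (ψ x))] at h1
  obtain ⟨r, rfl⟩ := g.exists_smul_eq_of_null (τ.timelike (ψ x)) h3 h2 (by linarith)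
    (hl.ne_zero x hx)
  rw [← hξ, map_smul, smul_apply, g.symm, hw, smul_zero]

lemma mvfderiv_eq_zero (τ : TimeOrientation g) (hl : IsNullNormalOn g ψ U l)
    {x : Cylinder} (hx : ψ x ∈ U) {f : M → ℝ}
    (hf : MDifferentiableAt 𝓘(ℝ, E4) 𝓘(ℝ, ℝ) f (ψ x)) (h0 : ∀ᶠ y in 𝓝 x, f (ψ y) = 0)
    {v : TS (ψ x)} (hv : g.inner (ψ x) v (l (ψ x)) = 0) : mvfderiv 𝓘(ℝ, E4) f (ψ x) v = 0 := by
  obtain ⟨u, rfl⟩ := h.isTangent_of_inner_eq_zero τ hl hx hv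
  exact mvfderiv_mfderiv_eq_zero
    (h.embedding.contMDiff.contMDiffAt.mdifferentiableAt (by simp)) hf h0 u

lemma eventually_mem (hl : IsNullNormalOn g ψ U l) {x : Cylinder} (hx : ψ x ∈ U) :
    ∀ᶠ y in 𝓝 x, ψ y ∈ U :=
  h.eventually (hl.isOpen.mem_nhds hx)

lemma inner_cov_normal (hD : IsLeviCivita g D) (τ : TimeOrientation g)
    (hl : IsNullNormalOn g ψ U l) {x : Cylinder} (hx : ψ x ∈ U) {v : TS (ψ x)}
    (hv : g.inner (ψ x) v (l (ψ x)) = 0) : g.inner (ψ x) (D l (ψ x) v) (l (ψ x)) = 0 := by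
  have hls := hl.smoothNear hx
  have h1 := h.mvfderiv_eq_zero τ hl hx
    ((hls.inner g hls).self_of_nhds.mdifferentiableAt (by simp)) (by
      filter_upwards [h.eventually_mem hl hx] with y hy
      exact h.inner_self hl hy) hv
  rw [hD.metric _ l l hls.differentiableAt hls.differentiableAt, g.symm _ (l (ψ x))] at h1
  linarith

/-- If $f$ vanishes on the hypersurface, so do $Xf$ and $Yf$, hence $[X,Y]f=X(Yf)-Y(Xf)$ does as
well; the bracket is therefore tangent. -/
lemma inner_mlieBracket_normal (τ : TimeOrientation g) (hl : IsNullNormalOn g ψ U l)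
    {x : Cylinder} (hx : ψ x ∈ U) {X Y : Π q : M, TangentSpace 𝓘(ℝ, E4) q}
    (hX : VFSmoothNear X (ψ x)) (hY : VFSmoothNear Y (ψ x))
    (hXl : ∀ᶠ q in 𝓝 (ψ x), g.inner q (X q) (l q) = 0)
    (hYl : ∀ᶠ q in 𝓝 (ψ x), g.inner q (Y q) (l q) = 0) :
    g.inner (ψ x) (mlieBracket 𝓘(ℝ, E4) X Y (ψ x)) (l (ψ x)) = 0 := by
  rw [g.symm]
  apply hl.normal x hx
  refine mem_range_mfderiv_of_forall_mvfderiv_eq_zero (h.embedding.isImmersion.isImmersionAt x)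
    fun f hf h0 ↦ ?_
  have hf2 : ContMDiffAt 𝓘(ℝ, E4) 𝓘(ℝ, ℝ) 2 f (ψ x) := hf.of_le ENat.LEInfty.out
  have hf2' := (contMDiffAt_iff_contMDiffAt_nhds (by simp)).1 hf2
  have key {Z : Π q : M, TangentSpace 𝓘(ℝ, E4) q}
      (hZl : ∀ᶠ q in 𝓝 (ψ x), g.inner q (Z q) (l q) = 0) :
      ∀ᶠ y in 𝓝 x, mvfderiv 𝓘(ℝ, E4) f (ψ y) (Z (ψ y)) = 0 := by
    filter_upwards [h.eventually hZl, h.eventually_mem hl hx, h.eventually hf2',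
      eventually_eventually_nhds.2 h0] with y h1 h2 h3 h4
    exact h.mvfderiv_eq_zero τ hl h2 (h3.mdifferentiableAt two_ne_zero) h4 h1
  rw [← mvfderiv_mvfderiv_apply_sub hf2 hX.differentiableAt hY.differentiableAt,
    h.mvfderiv_eq_zero τ hl hx (mdifferentiableAt_mvfderiv_apply hf2 hY.differentiableAt)
      (key hYl) hXl.self_of_nhds,
    h.mvfderiv_eq_zero τ hl hx (mdifferentiableAt_mvfderiv_apply hf2 hX.differentiableAt)
      (key hXl) hYl.self_of_nhds, sub_zero]

/-- The null second fundamental form is symmetric: null normals have no twist. -/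
lemma inner_cov_symm (hD : IsLeviCivita g D) (τ : TimeOrientation g)
    (hl : IsNullNormalOn g ψ U l) {x : Cylinder} (hx : ψ x ∈ U) {v w : TS (ψ x)}
    (hv : g.inner (ψ x) v (l (ψ x)) = 0) (hw : g.inner (ψ x) w (l (ψ x)) = 0) :
    g.inner (ψ x) (D l (ψ x) v) w = g.inner (ψ x) (D l (ψ x) w) v := by
  have hls := hl.smoothNear hx
  obtain ⟨X, hX, rfl, hXl⟩ := exists_extend_orthogonal hls (hl.ne_zero x hx) hv
  obtain ⟨Y, hY, rfl, hYl⟩ := exists_extend_orthogonal hls (hl.ne_zero x hx) hw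
  -- By torsion-freeness this reads $g(\nabla_XY,l)=g(\nabla_YX,l)$; orthogonality to $l$ moves the
  -- derivatives onto $l$.
  have hb := h.inner_mlieBracket_normal τ hl hx hX hY hXl hYl
  rw [hD.mlieBracket_eq hX.differentiableAt hY.differentiableAt, map_sub, sub_apply] at hb
  have h1 := hD.inner_cov_add_eq_zero hX hls hXl (Y (ψ x))
  have h2 := hD.inner_cov_add_eq_zero hY hls hYl (X (ψ x))
  rw [g.symm _ (X (ψ x))] at h1
  rw [g.symm _ (Y (ψ x))] at h2
  linarith

end IsNullHypersurface
end

/-! ### Raychaudhuri's equation. -/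

section
variable {M : Type*} [TopologicalSpace M] [ChartedSpace E4 M] [IsManifold 𝓘(ℝ, E4) ∞ M]
  {g : LorentzMetric M} {D : Connection M}
  {ψ : Cylinder → M} {U : Set M} {l : Π q : M, TangentSpace 𝓘(ℝ, E4) q}

namespace IsNullHypersurface
variable (h : IsNullHypersurface g ψ)
include h

lemma inner_cov_self_eq_zero (hD : IsLeviCivita g D) (τ : TimeOrientation g)
    (hl : IsNullNormalOn g ψ U l) {x : Cylinder} (hx : ψ x ∈ U) {v : TS (ψ x)}
    (hv : g.inner (ψ x) v (l (ψ x)) = 0) :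
    g.inner (ψ x) (D l (ψ x) (l (ψ x))) v = 0 := by
  rw [h.inner_cov_symm hD τ hl hx (h.inner_self hl hx) hv, h.inner_cov_normal hD τ hl hx hv]

/-- A null normal of a null hypersurface is pregeodesic. -/
lemma exists_surface_gravity (hD : IsLeviCivita g D) (τ : TimeOrientation g)
    (hl : IsNullNormalOn g ψ U l) {x : Cylinder} (hx : ψ x ∈ U) (t : NullTetrad g (ψ x))
    (ht : t.l = l (ψ x)) : ∃ κ : ℝ, D l (ψ x) (l (ψ x)) = κ • l (ψ x) := by
  refine ⟨g.inner (ψ x) (D l (ψ x) (l (ψ x))) t.n, ?_⟩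
  conv_lhs => rw [t.expand (D l (ψ x) (l (ψ x)))]
  have hxl : g.inner (ψ x) t.m.1 (l (ψ x)) = 0 := ht ▸ t.inner_x_l
  have hyl : g.inner (ψ x) t.m.2 (l (ψ x)) = 0 := ht ▸ t.inner_y_l
  rw [ht, h.inner_cov_self_eq_zero hD τ hl hx (h.inner_self hl hx),
    h.inner_cov_self_eq_zero hD τ hl hx hxl, h.inner_cov_self_eq_zero hD τ hl hx hyl]
  simp

/-- The evolution of $B(E,F)$ along $l$, from commuting $\nabla_l$ with $\nabla_E$. Only the value
of $\kappa$ at the point enters: $g(\nabla_E\nabla_l l,F)$ is found by differentiating $g(\nabla_l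
l,F)=0$ along the hypersurface, so no smooth $\kappa$ is required. -/
lemma mvfderiv_inner_cov (hD : IsLeviCivita g D) (τ : TimeOrientation g)
    (hl : IsNullNormalOn g ψ U l) {x : Cylinder} (hx : ψ x ∈ U) {κ : ℝ}
    (hκ : D l (ψ x) (l (ψ x)) = κ • l (ψ x)) {E F : Π q : M, TangentSpace 𝓘(ℝ, E4) q}
    (hE : VFSmoothNear E (ψ x)) (hF : VFSmoothNear F (ψ x))
    (hEl : ∀ᶠ q in 𝓝 (ψ x), g.inner q (E q) (l q) = 0)
    (hFl : ∀ᶠ q in 𝓝 (ψ x), g.inner q (F q) (l q) = 0) :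
    mvfderiv 𝓘(ℝ, E4) (fun q ↦ g.inner q (D l q (E q)) (F q)) (ψ x) (l (ψ x))
      = g.inner (ψ x) (curvature D (ψ x) (l (ψ x)) (E (ψ x)) (l (ψ x))) (F (ψ x))
        + κ * g.inner (ψ x) (D l (ψ x) (E (ψ x))) (F (ψ x))
        + g.inner (ψ x) (D l (ψ x) (D E (ψ x) (l (ψ x)))) (F (ψ x))
        + g.inner (ψ x) (D l (ψ x) (E (ψ x))) (D F (ψ x) (l (ψ x)))
        - g.inner (ψ x) (D l (ψ x) (D l (ψ x) (E (ψ x)))) (F (ψ x)) := by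
  have hls := hl.smoothNear hx
  have hK := hls.cov hD hls
  have h1 : mvfderiv 𝓘(ℝ, E4) (fun q ↦ g.inner q (D l q (l q)) (F q)) (ψ x) (E (ψ x)) = 0 := by
    refine h.mvfderiv_eq_zero τ hl hx
      ((hK.inner g hF).self_of_nhds.mdifferentiableAt (by simp)) ?_ hEl.self_of_nhds
    filter_upwards [h.eventually_mem hl hx, h.eventually hFl] with y hy hFy
    exact h.inner_cov_self_eq_zero hD τ hl hy hFy
  rw [hD.metric _ (fun q ↦ D l q (l q)) F hK.differentiableAt hF.differentiableAt, hκ,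
    map_smul, smul_apply, smul_eq_mul] at h1
  have h2 := hD.inner_cov_add_eq_zero hF hls hFl (E (ψ x))
  rw [g.symm _ (D F _ _), g.symm _ (F _)] at h2
  rw [hD.metric _ (fun q ↦ D l q (E q)) F (hls.cov hD hE).differentiableAt hF.differentiableAt,
    hD.curvature_eq hls hE hls, curvatureVF, hD.mlieBracket_eq hls.differentiableAt
      hE.differentiableAt]
  simp only [map_sub, sub_apply]
  linear_combination h1 - κ * h2

/-- Raychaudhuri's equation on a null hypersurface of vanishing expansion. -/
lemma ricci_eq_of_expansion_eq_zero (hD : IsLeviCivita g D) (τ : TimeOrientation g)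
    (hl : IsNullNormalOn g ψ U l)
    (hθ : ∀ y, ψ y ∈ U → ∀ t : NullTetrad g (ψ y), t.l = l (ψ y) → expansion g D l t = 0)
    {x : Cylinder} (hx : ψ x ∈ U) (t : NullTetrad g (ψ x)) (ht : t.l = l (ψ x)) :
    ricci D (ψ x) t.l t.l = 4 * (g.inner (ψ x) (D l (ψ x) t.m.1) t.m.1 ^ 2
      + 2 * g.inner (ψ x) (D l (ψ x) t.m.1) t.m.2 ^ 2
      + g.inner (ψ x) (D l (ψ x) t.m.2) t.m.2 ^ 2) := by
  have hls := hl.smoothNear hx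
  obtain ⟨κ, hκ⟩ := h.exists_surface_gravity hD τ hl hx t ht
  have hxl : g.inner (ψ x) t.m.1 (l (ψ x)) = 0 := ht ▸ t.inner_x_l
  have hyl : g.inner (ψ x) t.m.2 (l (ψ x)) = 0 := ht ▸ t.inner_y_l
  obtain ⟨E, hE, hEp, hEl⟩ := exists_extend_orthogonal hls (hl.ne_zero x hx) hxl
  obtain ⟨F, hF, hFp, hFl⟩ := exists_extend_orthogonal hls (hl.ne_zero x hx) hyl
  have hK := VFSmoothNear.extend t.n
  -- the trace-free condition in the frame `E`, `F` along the hypersurface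
  have hEE := hE.inner g hE
  have hEF := hE.inner g hF
  have hFF := hF.inner g hF
  have hSEE := (hls.cov hD hE).inner g hE
  have hSEF := (hls.cov hD hE).inner g hF
  have hSFE := (hls.cov hD hF).inner g hE
  have hSFF := (hls.cov hD hF).inner g hF
  have diff {f : M → ℝ} (hf : ∀ᶠ q in 𝓝 (ψ x), ContMDiffAt 𝓘(ℝ, E4) 𝓘(ℝ, ℝ) ∞ f q) :
      MDifferentiableAt 𝓘(ℝ, E4) 𝓘(ℝ, ℝ) f (ψ x) := hf.self_of_nhds.mdifferentiableAt (by simp)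
  have hneg : ∀ᶠ q in 𝓝 (ψ x), g.inner q (E q) (E q) < 0 := by
    apply hEE.self_of_nhds.continuousAt.eventually_lt_const
    beta_reduce
    rw [hEp, t.inner_x_x]; norm_num
  have hpos : ∀ᶠ q in 𝓝 (ψ x),
      0 < g.inner q (E q) (E q) * g.inner q (F q) (F q) - g.inner q (E q) (F q) ^ 2 := by
    apply ((hEE.self_of_nhds.continuousAt.mul hFF.self_of_nhds.continuousAt).sub
      (hEF.self_of_nhds.continuousAt.pow 2)).eventually_const_lt
    simp only [Pi.mul_apply, Pi.sub_apply, Pi.pow_apply]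
    rw [hEp, hFp, t.inner_x_x, t.inner_x_y, t.inner_y_y]; norm_num
  have hne : ∀ᶠ q in 𝓝 (ψ x), g.inner q (FiberBundle.extend E4 t.n q) (l q) ≠ 0 := by
    apply (hK.inner g hls).self_of_nhds.continuousAt.eventually_ne
    rw [FiberBundle.extend_apply_self, ← ht, t.inner_n_l]
    norm_num
  have hzero : ∀ᶠ y in 𝓝 x, ((fun q ↦ g.inner q (F q) (F q))
        * (fun q ↦ g.inner q (D l q (E q)) (E q))
      - (fun q ↦ g.inner q (E q) (F q)) * ((fun q ↦ g.inner q (D l q (E q)) (F q))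
        + fun q ↦ g.inner q (D l q (F q)) (E q))
      + (fun q ↦ g.inner q (E q) (E q)) * fun q ↦ g.inner q (D l q (F q)) (F q)) (ψ y) = 0 := by
    filter_upwards [h.eventually_mem hl hx, h.eventually hEl, h.eventually hFl, h.eventually hneg,
      h.eventually hpos, h.eventually hne] with y hy h1 h2 h3 h4 h5
    exact screen_trace_eq_zero (h.inner_self hl hy) h5 h1 h2 h3 h4 (hθ y hy)
  -- The identity holds only on the hypersurface, but $l$ is tangent to it, so its derivative along
  -- $l$ vanishes.
  have hd := h.mvfderiv_eq_zero τ hl hx ((((diff hFF).mul (diff hSEE)).sub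
    ((diff hEF).mul ((diff hSEF).add (diff hSFE)))).add ((diff hEE).mul (diff hSFF))) hzero
    (h.inner_self hl hx)
  rw [mvfderiv_add (((diff hFF).mul (diff hSEE)).sub
    ((diff hEF).mul ((diff hSEF).add (diff hSFE)))) ((diff hEE).mul (diff hSFF)),
    mvfderiv_sub ((diff hFF).mul (diff hSEE)) ((diff hEF).mul ((diff hSEF).add (diff hSFE))),
    mvfderiv_mul (diff hFF) (diff hSEE), mvfderiv_mul (diff hEE) (diff hSFF),
    mvfderiv_mul (diff hEF) ((diff hSEF).add (diff hSFE)),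
    mvfderiv_add (diff hSEF) (diff hSFE)] at hd
  simp only [add_apply, sub_apply, smul_apply, smul_eq_mul, Pi.add_apply] at hd
  rw [h.mvfderiv_inner_cov hD τ hl hx hκ hE hE hEl hEl,
    h.mvfderiv_inner_cov hD τ hl hx hκ hF hF hFl hFl,
    hD.metric _ F F hF.differentiableAt hF.differentiableAt,
    hD.metric _ E E hE.differentiableAt hE.differentiableAt,
    hD.metric _ E F hE.differentiableAt hF.differentiableAt, hEp, hFp, t.inner_x_x, t.inner_x_y,
    t.inner_y_y] at hd
  have hθx := hθ x hx t ht
  rw [expansion_eq] at hθx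
  have hsymm := h.inner_cov_symm hD τ hl hx hyl hxl
  -- the connection form of the frame
  have hEll := hD.inner_cov_add_eq_zero hE hls hEl (l (ψ x))
  have hFll := hD.inner_cov_add_eq_zero hF hls hFl (l (ψ x))
  rw [hEp, hκ, map_smul, hxl, smul_zero, add_zero] at hEll
  rw [hFp, hκ, map_smul, hyl, smul_zero, add_zero] at hFll
  -- A vector orthogonal to $l$ has no $n$ component, and its $l$ component contributes nothing
  -- because $B(l,\cdot)=0$.
  have hB {u v : TS (ψ x)} (hu : g.inner (ψ x) u (l (ψ x)) = 0)
      (hv : g.inner (ψ x) v (l (ψ x)) = 0) : g.inner (ψ x) (D l (ψ x) u) v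
        = -2 * g.inner (ψ x) u t.m.1 * g.inner (ψ x) (D l (ψ x) t.m.1) v
          - 2 * g.inner (ψ x) u t.m.2 * g.inner (ψ x) (D l (ψ x) t.m.2) v := by
    conv_lhs => rw [t.expand u]
    simp only [ht, hu, zero_smul, add_zero, map_add, map_smul, add_apply, smul_apply, smul_eq_mul,
      h.inner_cov_self_eq_zero hD τ hl hx hv]
    ring
  have hS : g.inner (ψ x) (D l (ψ x) t.m.2) t.m.2 = -g.inner (ψ x) (D l (ψ x) t.m.1) t.m.1 := by
    linarith
  -- In the end the derivatives of the Gram entries cancel the terms with $\nabla_lE,\nabla_lF$, the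
  -- $\kappa$ terms drop out with the trace, and $B(\nabla_El,E)$, $B(\nabla_Fl,F)$ give the
  -- squares.
  rw [h.inner_cov_symm hD τ hl hx hxl hEll, h.inner_cov_symm hD τ hl hx hyl hFll, hB hEll hxl,
    hB hFll hyl, hB (h.inner_cov_normal hD τ hl hx hxl) hxl,
    hB (h.inner_cov_normal hD τ hl hx hyl) hyl, hsymm, hS, g.symm _ t.m.1 (D E _ _),
    g.symm _ t.m.1 (D F _ _), g.symm _ t.m.2 (D F _ _)] at hd
  -- The two terms of the trace involving $n$ vanish by the skew symmetries of the curvature; only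
  -- the screen terms remain.
  rw [hD.ricci_eq t, curvature_self, ht, hD.inner_curvature_self, hS]
  simp only [map_zero, zero_apply]
  linear_combination 4 * hd

end IsNullHypersurface
end

/-! ### The energy condition and the vanishing of the screen components. -/

section
variable {M : Type*} [TopologicalSpace M] [ChartedSpace E4 M] [IsManifold 𝓘(ℝ, E4) ∞ M]
  {g : LorentzMetric M} {D : Connection M} {τ : TimeOrientation g}
  {T : Π p : M, TS p →L[ℝ] TS p →L[ℝ] ℝ}
  {ψ : Cylinder → M} {U : Set M} {l : Π q : M, TangentSpace 𝓘(ℝ, E4) q}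

namespace IsNonExpandingHorizon

lemma energy_nonneg_of_futurePointing (h : IsNonExpandingHorizon g D τ T ψ) {x : Cylinder}
    {v : TS (ψ x)} (hv : IsNormal g ψ x v) (hf : FuturePointing g τ (ψ x) v) :
    0 ≤ T (ψ x) v v := by
  obtain ⟨V, hV, hV'⟩ := h.energy x v hv hf
  rw [← hV]
  rcases hV' with rfl | hV'
  · simp
  · exact g.inner_nonneg_of_futurePointing hV' hf

/-- $T(v,v)$ is even in $v$, so a past pointing normal reduces to a future pointing one; a normal
orthogonal to the time orientation is zero. -/
lemma energy_nonneg (h : IsNonExpandingHorizon g D τ T ψ) {x : Cylinder}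
    {v : TS (ψ x)} (hv : IsNormal g ψ x v) : 0 ≤ T (ψ x) v v := by
  have hn := h.nullHypersurface.null x v hv
  rcases lt_trichotomy (g.inner (ψ x) v (τ.field (ψ x))) 0 with h0 | h0 | h0
  · have := h.energy_nonneg_of_futurePointing (v := -v)
      (fun w hw ↦ by simp [hv w hw]) ⟨by simp [hn], by simpa using h0⟩
    simpa using this
  · have : v = 0 := g.eq_zero_of_orthogonal_timelike (τ.timelike _) hn.ge h0
    simp [this]
  · exact h.energy_nonneg_of_futurePointing hv ⟨hn.ge, h0⟩

lemma ricci_nonpos (h : IsNonExpandingHorizon g D τ T ψ) {x : Cylinder}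
    {v : TS (ψ x)} (hv : IsNormal g ψ x v) : ricci D (ψ x) v v ≤ 0 := by
  have he := h.einstein x v v
  rw [h.nullHypersurface.null x v hv] at he
  nlinarith [Real.pi_pos, h.energy_nonneg hv]

lemma screen_cov_eq_zero (h : IsNonExpandingHorizon g D τ T ψ) (hD : IsLeviCivita g D)
    (hl : IsNullNormalOn g ψ U l) {x : Cylinder} (hx : ψ x ∈ U) (t : NullTetrad g (ψ x))
    (ht : t.l = l (ψ x)) :
    ricci D (ψ x) t.l t.l = 0 ∧
      g.inner (ψ x) (D l (ψ x) t.m.1) t.m.1 = 0 ∧ g.inner (ψ x) (D l (ψ x) t.m.1) t.m.2 = 0 ∧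
      g.inner (ψ x) (D l (ψ x) t.m.2) t.m.1 = 0 ∧ g.inner (ψ x) (D l (ψ x) t.m.2) t.m.2 = 0 := by
  have hxl : g.inner (ψ x) t.m.1 (l (ψ x)) = 0 := ht ▸ t.inner_x_l
  have hyl : g.inner (ψ x) t.m.2 (l (ψ x)) = 0 := ht ▸ t.inner_y_l
  have hr := h.nullHypersurface.ricci_eq_of_expansion_eq_zero hD τ hl
    (h.expansion_eq_zero U l hl) hx t ht
  have hr' := h.ricci_nonpos (hl.normal x hx)
  rw [← ht] at hr'
  rw [h.nullHypersurface.inner_cov_symm hD τ hl hx hyl hxl]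
  set a := g.inner (ψ x) (D l (ψ x) t.m.1) t.m.1
  set b := g.inner (ψ x) (D l (ψ x) t.m.1) t.m.2
  set c := g.inner (ψ x) (D l (ψ x) t.m.2) t.m.2
  have ha : a ^ 2 = 0 := by linarith [sq_nonneg a, sq_nonneg b, sq_nonneg c]
  have hb : b ^ 2 = 0 := by linarith [sq_nonneg a, sq_nonneg b, sq_nonneg c]
  have hc : c ^ 2 = 0 := by linarith [sq_nonneg a, sq_nonneg b, sq_nonneg c]
  exact ⟨by rw [hr, ha, hb, hc]; norm_num, pow_eq_zero_iff two_ne_zero |>.1 ha,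
    pow_eq_zero_iff two_ne_zero |>.1 hb, pow_eq_zero_iff two_ne_zero |>.1 hb,
    pow_eq_zero_iff two_ne_zero |>.1 hc⟩

end IsNonExpandingHorizon
end

end NonExpanding

end

theorem mainTheorem1 {M : Type*} [TopologicalSpace M] [ChartedSpace NonExpanding.E4 M]
    [IsManifold 𝓘(ℝ, NonExpanding.E4) ∞ M] [T2Space M] [SecondCountableTopology M]
    (g : NonExpanding.LorentzMetric M) (D : NonExpanding.Connection M)
    (hD : NonExpanding.IsLeviCivita g D) (τ : NonExpanding.TimeOrientation g)
    (T : Π p : M, NonExpanding.TS p →L[ℝ] NonExpanding.TS p →L[ℝ] ℝ)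
    (ψ : NonExpanding.Cylinder → M)
    (hψ : NonExpanding.IsNonExpandingHorizon g D τ T ψ)
    (U : Set M) (l : Π p : M, TangentSpace 𝓘(ℝ, NonExpanding.E4) p)
    (hl : NonExpanding.IsNullNormalOn g ψ U l)
    (x : NonExpanding.Cylinder) (hx : ψ x ∈ U)
    (t : NonExpanding.NullTetrad g (ψ x)) (ht : t.l = l (ψ x)) :
    (∀ v w, NonExpanding.twistTensor g D l t v w = 0) ∧
    (∀ v w, NonExpanding.shearTensor g D l t v w = 0) ∧
    NonExpanding.spinRho g D l t = 0 ∧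
    NonExpanding.spinSigma g D l t = 0 ∧
    NonExpanding.Phi00 D t = 0 := by
  obtain ⟨hr, h11, h12, h21, h22⟩ := hψ.screen_cov_eq_zero hD hl hx t ht
  -- The projection lands in the span of $x$ and $y$, where all four components of $\nabla l$ are
  -- zero.
  have hP (v w : NonExpanding.TS (ψ x)) : g.inner (ψ x)
      (D l (ψ x) (NonExpanding.screenProj t v)) (NonExpanding.screenProj t w) = 0 := by
    simp [NonExpanding.screenProj, h11, h12, h21, h22]
  refine ⟨fun v w ↦ ?_, fun v w ↦ ?_, ?_, ?_, ?_⟩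
  · simp [NonExpanding.twistTensor, hP]
  · simp [NonExpanding.shearTensor, hP, hψ.expansion_eq_zero U l hl x hx t ht]
  · simp [NonExpanding.spinRho, NonExpanding.innerC, NonExpanding.covC, NonExpanding.conjV,
      g.symm _ t.m.1, g.symm _ t.m.2, h11, h12, h21, h22, Complex.ext_iff]
  · simp [NonExpanding.spinSigma, NonExpanding.innerC, NonExpanding.covC,
      g.symm _ t.m.1, g.symm _ t.m.2, h11, h12, h21, h22, Complex.ext_iff]
  · simp [NonExpanding.Phi00, hr]
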